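/- Let $\Omega\subset\mathbb C^m$ be a bounded domain and let $\mathcal A(\Omega)$ be the closure, in the supremum norm on $\Omega$, of the algebra of functions holomorphic in some neighbourhood of $\overline\Omega$. A Hilbert module over $\mathcal A(\Omega)$ is a complex Hilbert space with a continuous unital $\mathcal A(\Omega)$-module structure in which the constants act as scalars; module maps are bounded. For $\underline z\in\Omega$ let $\mathcal M\otimes_{\mathcal A}\mathbb C_{\underline z}$ be the quotient of $\mathcal M\otimes\mathbb C$ by the closed span of the vectors $\varphi f\otimes a-f\otimes\varphi(\underline z)a$, and write $f\otimes_{\mathcal A}1_{\underline z}$ for the class of $f\otimes 1$. A Hilbert module $\mathcal R$ is quasi-free of rank $k\ge 1$ ($k$ a cardinal) if it has a family $\{f_i\}$ of $k$ vectors that generates it (the finite sums $\sum\varphi_if_i$ are dense) such that (i) for every $\underline z\in\Omega$ the vectors $f_i\otimes_{\mathcal A}1_{\underline z}$ are linearly independent and have dense linear span in $\mathcal R\otimes_{\mathcal A}\mathbb C_{\underline z}$; (ii) the maps $f_i\otimes_{\mathcal A}1_{\underline z}\mapsto e_i$ from the linear span of these vectors to $\ell^2_k$ are bounded, locally uniformly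 in $\underline z\in\Omega$; (iii) for $f\in\mathcal R$, $f\otimes_{\mathcal A}1_{\underline z}=0$ for all $\underline z\in\Omega$ if and only if $f=0$. A weak resolution of $\mathcal M$ by quasi-free Hilbert modules is a finite or infinite sequence of module maps $$0\longleftarrow\mathcal M\stackrel{X_0}{\longleftarrow}\mathcal R_1\stackrel{X_1}{\longleftarrow}\mathcal R_2\stackrel{X_2}{\longleftarrow}\cdots$$ with each $\mathcal R_i$ quasi-free (the last one being followed by $0$ if the sequence is finite), such that $X_0$ has dense range and $\ker X_i=\overline{\operatorname{ran}X_{i+1}}$ for all $i\ge 0$. The module $\mathcal M$ is weakly regular if there is a module map with dense range from a quasi-free Hilbert module to $\mathcal M$. The module $\mathcal M$ is compactly supported on $f\in\mathcal M$ if there are a compact set $X\subset\Omega$ and a constant $\beta$ with $\|\varphi f\|\le\beta\,\|\varphi\|_X\|f\|$ for all $\varphi\in\mathcal A(\Omega)$, where $\|\varphi\|_X=\sup_X|\varphi|$; it is compactly supported if one $X$ and one $\beta$ work for all $f\in\mathcal M$; it is almost compactly supported if the vectors on which it is compactly supported have dense linear span in $\mathcal M$. Theorem. Every almost compactly supported Hilbert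 module $\mathcal M$ over $\mathcal A(\Omega)$ has a weak resolution by quasi-free Hilbert modules; if $\mathcal M$ is separable, the resolution can be chosen with all ranks at most $\aleph_0$. In particular, every compactly supported Hilbert module over $\mathcal A(\Omega)$ is weakly regular. -/

import Mathlib

open scoped BoundedContinuousFunction TensorProduct Topology Cardinal

universe u

namespace QuasiFreeRes

/-- The algebra of (bounded, continuous) functions on `Ω` that are restrictions to `Ω` of functions
holomorphic on some open neighbourhood of the closure of `Ω`. -/
def holoNearClosure {m : ℕ} (Ω : Set (Fin m → ℂ)) : Subalgebra ℂ (Ω →ᵇ ℂ) where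
  carrier := {g | ∃ (U : Set (Fin m → ℂ)) (F : (Fin m → ℂ) → ℂ),
    IsOpen U ∧ closure Ω ⊆ U ∧ DifferentiableOn ℂ F U ∧ ∀ z : Ω, g z = F z}
  mul_mem' := by
    rintro a b ⟨U, F, hU, hΩU, hF, haF⟩ ⟨V, G, hV, hΩV, hG, hbG⟩
    exact ⟨U ∩ V, fun z => F z * G z, hU.inter hV, Set.subset_inter hΩU hΩV,
      (hF.mono Set.inter_subset_left).mul (hG.mono Set.inter_subset_right),
      fun z => by simp [haF, hbG]⟩
  add_mem' := by
    rintro a b ⟨U, F, hU, hΩU, hF, haF⟩ ⟨V, G, hV, hΩV, hG, hbG⟩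
    exact ⟨U ∩ V, fun z => F z + G z, hU.inter hV, Set.subset_inter hΩU hΩV,
      (hF.mono Set.inter_subset_left).add (hG.mono Set.inter_subset_right),
      fun z => by simp [haF, hbG]⟩
  algebraMap_mem' := fun c =>
    ⟨Set.univ, fun _ => c, isOpen_univ, Set.subset_univ _, differentiableOn_const c,
      fun _ => rfl⟩

/-- The function algebra `𝒜(Ω)`: the closure, in the supremum norm on `Ω`, of the functions
holomorphic in a neighbourhood of the closure of `Ω`. -/
def FunAlg {m : ℕ} (Ω : Set (Fin m → ℂ)) : Type := (holoNearClosure Ω).topologicalClosure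

noncomputable instance {m : ℕ} (Ω : Set (Fin m → ℂ)) : NormedCommRing (FunAlg Ω) :=
  inferInstanceAs (NormedCommRing (holoNearClosure Ω).topologicalClosure)

noncomputable instance {m : ℕ} (Ω : Set (Fin m → ℂ)) : NormedAlgebra ℂ (FunAlg Ω) :=
  inferInstanceAs (NormedAlgebra ℂ (holoNearClosure Ω).topologicalClosure)

/-- Evaluation of `φ ∈ 𝒜(Ω)` at points of `Ω`. -/
noncomputable instance {m : ℕ} (Ω : Set (Fin m → ℂ)) : CoeFun (FunAlg Ω) fun _ => Ω → ℂ :=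
  ⟨fun φ => (φ.1 : Ω →ᵇ ℂ)⟩

/-- A Hilbert module over `𝒜(Ω)`: a complex Hilbert space with a (jointly) continuous unital
`𝒜(Ω)`-module structure in which the constants act as scalars. -/
structure HilbertModule {m : ℕ} (Ω : Set (Fin m → ℂ)) : Type (u + 1) where
  carrier : Type u
  [normedAddCommGroup : NormedAddCommGroup carrier]
  [innerProductSpace : InnerProductSpace ℂ carrier]
  [completeSpace : CompleteSpace carrier]
  [module : Module (FunAlg Ω) carrier]
  [isScalarTower : IsScalarTower ℂ (FunAlg Ω) carrier]
  [continuousSMul : ContinuousSMul (FunAlg Ω) carrier]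

instance {m : ℕ} (Ω : Set (Fin m → ℂ)) : CoeSort (HilbertModule.{u} Ω) (Type u) :=
  ⟨HilbertModule.carrier⟩

attribute [instance] HilbertModule.normedAddCommGroup HilbertModule.innerProductSpace
  HilbertModule.completeSpace HilbertModule.module HilbertModule.isScalarTower
  HilbertModule.continuousSMul

variable {m : ℕ} {Ω : Set (Fin m → ℂ)}

/-- The closed subspace of the Hilbert space tensor product `M ⊗ ℂ` generated by the vectors
`φ f ⊗ a - f ⊗ φ(z) a`. (The space `M ⊗ ℂ`, with Mathlib's inner product, is isometric to `M`
and hence already complete.) -/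
noncomputable def fiberRel (M : HilbertModule.{u} Ω) (z : Ω) : Submodule ℂ (M ⊗[ℂ] ℂ) :=
  (Submodule.span ℂ {x | ∃ (φ : FunAlg Ω) (f : M) (a : ℂ),
    x = (φ • f) ⊗ₜ[ℂ] a - f ⊗ₜ[ℂ] (φ z * a)}).topologicalClosure

/-- The fibre `Sp_z(M) = M ⊗_𝒜 ℂ_z` of the spectral sheaf at `z ∈ Ω`, with the quotient norm. -/
abbrev Fiber (M : HilbertModule.{u} Ω) (z : Ω) : Type u := (M ⊗[ℂ] ℂ) ⧸ fiberRel M z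

/-- The vector `f ⊗_𝒜 1_z` of the fibre at `z`. -/
noncomputable def loc {M : HilbertModule.{u} Ω} (z : Ω) (f : M) : Fiber M z :=
  (fiberRel M z).mkQ (f ⊗ₜ[ℂ] (1 : ℂ))

/-- `M` is quasi-free relative to the family `f`, indexed by a set of cardinality the rank. -/
structure IsQuasiFreeRel (M : HilbertModule.{u} Ω) {ι : Type u} (f : ι → M) : Prop where
  /-- the family generates `M` as a Hilbert module -/
  generates : closure (Submodule.span (FunAlg Ω) (Set.range f) : Set M) = Set.univ
  /-- the localizations of the generators are linearly independent and span each fibre -/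
  linearIndependent : ∀ z : Ω, LinearIndependent ℂ fun i => loc z (f i)
  spans : ∀ z : Ω,
    closure (Submodule.span ℂ (Set.range fun i => loc z (f i)) : Set (Fiber M z)) = Set.univ
  /-- the maps `X_z : f_i ⊗ 1_z ↦ e_i` from the linear span of the `f_i ⊗ 1_z` to `ℓ²(ι)` are
  locally uniformly bounded in norm -/
  locallyBounded : ∀ z₀ : Ω, ∃ C : ℝ, ∀ᶠ z in 𝓝 z₀, ∀ c : ι →₀ ℂ,
    Real.sqrt (∑ i ∈ c.support, ‖c i‖ ^ 2) ≤ C * ‖c.sum fun i a => a • loc z (f i)‖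
  /-- a vector vanishes if and only if all its localizations do -/
  separates : ∀ g : M, (∀ z : Ω, loc z g = 0) ↔ g = 0

/-- `M` is quasi-free of rank `k`, where `k ≥ 1` is a cardinal. -/
def IsQuasiFree (M : HilbertModule.{u} Ω) (k : Cardinal.{u}) : Prop :=
  1 ≤ k ∧ ∃ (ι : Type u) (f : ι → M), #ι = k ∧ IsQuasiFreeRel M f

/-- `M` is weakly regular: some module map from a quasi-free Hilbert module has dense range. -/
def IsWeaklyRegular (M : HilbertModule.{u} Ω) : Prop :=
  ∃ (R : HilbertModule.{u} Ω) (k : Cardinal.{u}) (X : R →L[FunAlg Ω] M),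
    IsQuasiFree R k ∧ DenseRange X

/-- A weak resolution `0 ← M ← R₀ ← R₁ ← ⋯` of `M` by quasi-free Hilbert modules. Its length may be
finite or infinite; the terms from the length on are zero. -/
structure WeakResolution (M : HilbertModule.{u} Ω) where
  length : ℕ∞
  term : ℕ → HilbertModule.{u} Ω
  rank : ℕ → Cardinal.{u}
  quasiFree : ∀ n : ℕ, (n : ℕ∞) < length → IsQuasiFree (term n) (rank n)
  eq_zero : ∀ n : ℕ, length ≤ (n : ℕ∞) → Subsingleton (term n)
  aug : term 0 →L[FunAlg Ω] M
  map : ∀ n : ℕ, term (n + 1) →L[FunAlg Ω] term n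
  denseRange_aug : DenseRange aug
  ker_aug : {x | aug x = 0} = closure (Set.range (map 0))
  ker_map : ∀ n : ℕ, {x | map n x = 0} = closure (Set.range (map (n + 1)))

/-- The supremum norm of `φ ∈ 𝒜(Ω)` on a subset `X` of `Ω`. -/
noncomputable def supNormOn (X : Set Ω) (φ : FunAlg Ω) : ℝ := ⨆ z : X, ‖φ z‖

/-- `M` is compactly supported on the vector `f`. -/
def CompactlySupportedOn (M : HilbertModule.{u} Ω) (f : M) : Prop :=
  ∃ (X : Set Ω) (β : ℝ), IsCompact X ∧ ∀ φ : FunAlg Ω, ‖φ • f‖ ≤ β * supNormOn X φ * ‖f‖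

/-- `M` is compactly supported: one compact set and one constant work for all vectors. -/
def IsCompactlySupported (M : HilbertModule.{u} Ω) : Prop :=
  ∃ (X : Set Ω) (β : ℝ), IsCompact X ∧
    ∀ (f : M) (φ : FunAlg Ω), ‖φ • f‖ ≤ β * supNormOn X φ * ‖f‖

/-- `M` is almost compactly supported: it is the closed linear span of the vectors on which it is
compactly supported. -/
def IsAlmostCompactlySupported (M : HilbertModule.{u} Ω) : Prop :=
  closure (Submodule.span ℂ {f : M | CompactlySupportedOn M f} : Set M) = Set.univ

end QuasiFreeRes

/-! ### The function algebra and the mean value property over balls. -/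

namespace QuasiFreeRes

variable {m : ℕ} {Ω : Set (Fin m → ℂ)}

open MeasureTheory Filter Metric

namespace FunAlg

/-! Measure `𝒜(Ω)` by the norm of `L²(Ω)`: point evaluations are bounded for it, locally uniformly
(`exists_norm_apply_le_toL2`), and multiplication by `φ` costs at most the factor `‖φ‖`. Given a
family `fᵢ` in a Hilbert module, complete the free module of finitely supported `Φ` in the graph
norm with square `∑ ‖Φᵢ‖² + ‖∑ Φᵢ fᵢ‖²`. This completion is a Hilbert module, `Φ ↦ ∑ Φᵢ fᵢ` extends
to a module map on it, and bounded evaluations give the conditions on the fibres. Separation by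
localizations holds as soon as `Φ ↦ ∑ Φᵢ fᵢ` is closable on the `ℓ²` sum of copies of `L²(Ω)`. So a
closable family yields a quasi-free module that maps densely into the closed submodule generated by
the family (`IsClosableFamily.exists_isQuasiFree`).

Closable families arise in two ways. In a module separated by its localizations every orthonormal
family is closable (`isClosableFamily_of_orthonormal`); an orthonormal basis of a kernel then
continues the resolution (`exists_isQuasiFree_ker`). To start it, compact support makes orbit maps
`φ ↦ φ f` bounded for the `L²` norm. The module is an orthogonal sum of separable reducing
submodules, and in each of them a total sequence of such vectors, scaled geometrically, is
available; together these form a closable family (`isClosableFamily_of_orthogonal`). -/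

@[simp] lemma mul_apply (φ ψ : FunAlg Ω) (z : Ω) : (φ * ψ) z = φ z * ψ z := rfl

@[simp] lemma one_apply (z : Ω) : (1 : FunAlg Ω) z = 1 := rfl

@[simp] lemma zero_apply (z : Ω) : (0 : FunAlg Ω) z = 0 := rfl

lemma norm_apply_le (φ : FunAlg Ω) (z : Ω) : ‖φ z‖ ≤ ‖φ‖ :=
  BoundedContinuousFunction.norm_coe_le_norm (φ.1 : Ω →ᵇ ℂ) z

/-- The inclusion of `𝒜(Ω)` in the bounded continuous functions. -/
noncomputable def incl (Ω : Set (Fin m → ℂ)) : FunAlg Ω →L[ℂ] (Ω →ᵇ ℂ) :=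
  (Subalgebra.toSubmodule (holoNearClosure Ω).topologicalClosure).subtypeL

/-- Evaluation at a point as a continuous linear functional. -/
noncomputable def evalCLM (z : Ω) : FunAlg Ω →L[ℂ] ℂ :=
  LinearMap.mkContinuous
    { toFun := fun φ => φ z, map_add' := fun _ _ => rfl, map_smul' := fun _ _ => rfl } 1
    (fun φ => by rw [one_mul]; exact norm_apply_le φ z)

/-- A closed condition that holds for functions holomorphic near the closure holds on `𝒜(Ω)`. -/
lemma induction_closed {p : FunAlg Ω → Prop} (hp : IsClosed {φ | p φ})
    (h : ∀ (φ : FunAlg Ω) (U : Set (Fin m → ℂ)) (F : (Fin m → ℂ) → ℂ), IsOpen U → closure Ω ⊆ U →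
      DifferentiableOn ℂ F U → (∀ z : Ω, φ z = F z) → p φ) (φ : FunAlg Ω) : p φ := by
  have hφ : (φ.1 : Ω →ᵇ ℂ) ∈ closure (holoNearClosure Ω : Set (Ω →ᵇ ℂ)) := φ.2
  obtain ⟨u, hu, hlim⟩ := mem_closure_iff_seq_limit.1 hφ
  have hu' (n) : u n ∈ (holoNearClosure Ω).topologicalClosure :=
    (holoNearClosure Ω).le_topologicalClosure (hu n)
  let v : ℕ → FunAlg Ω := fun n => ⟨u n, hu' n⟩
  have hv : Tendsto v atTop (𝓝 φ) := tendsto_subtype_rng.2 hlim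
  refine hp.mem_of_tendsto hv (Eventually.of_forall fun n => ?_)
  obtain ⟨U, F, hU, hΩ, hF, hFu⟩ := hu n
  exact h _ U F hU hΩ hF hFu

/-- `𝒜(Ω)` is separable when `Ω` is bounded. -/
lemma separableSpace (hbdd : Bornology.IsBounded Ω) :
    TopologicalSpace.SeparableSpace (FunAlg Ω) := by
  have : CompactSpace (closure Ω) := isCompact_iff_compactSpace.1 hbdd.isCompact_closure
  -- A function holomorphic near the closure is the restriction of a continuous function on this
  -- compact metric space, and `C(closure Ω, ℂ)` is separable.
  let r : C(closure Ω, ℂ) → (Ω →ᵇ ℂ) := fun g =>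
    (BoundedContinuousFunction.mkOfCompact g).compContinuous
      ⟨Set.inclusion subset_closure, continuous_inclusion subset_closure⟩
  have hr : Continuous r := by
    refine LipschitzWith.continuous (K := 1) (LipschitzWith.of_dist_le_mul fun g h => ?_)
    rw [BoundedContinuousFunction.dist_le (by positivity)]
    intro z
    simpa [r] using ContinuousMap.dist_apply_le_dist (f := g) (g := h) _
  have hsep : TopologicalSpace.IsSeparable (Set.range r) := TopologicalSpace.isSeparable_range hr
  have hsub : (holoNearClosure Ω : Set (Ω →ᵇ ℂ)) ⊆ Set.range r := by
    rintro g ⟨U, F, hU, hΩ, hF, hg⟩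
    refine ⟨⟨fun z => F z, ?_⟩, ?_⟩
    · exact (hF.continuousOn.mono hΩ).domRestrict
    · ext z
      exact (hg z).symm
  exact (hsep.mono hsub).closure.separableSpace

end FunAlg

/-- Multiplication by a unimodular scalar preserves Lebesgue measure on `ℂᵐ`. -/
lemma measurePreserving_circle_smul (c : Circle) :
    MeasurePreserving (fun w : Fin m → ℂ => (c : ℂ) • w) volume volume :=
  volume_preserving_pi fun _ => (rotation c).measurePreserving

lemma setIntegral_circle_smul (F : (Fin m → ℂ) → ℂ) (r : ℝ) (c : Circle) :
    ∫ w in closedBall 0 r, F ((c : ℂ) • w) = ∫ w in closedBall 0 r, F w := by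
  have hc := measurePreserving_circle_smul (m := m) c
  have hemb : MeasurableEmbedding (fun w : Fin m → ℂ => (c : ℂ) • w) :=
    (Homeomorph.smulOfNeZero (c : ℂ) c.coe_ne_zero).measurableEmbedding
  have hpre : (fun w : Fin m → ℂ => (c : ℂ) • w) ⁻¹' closedBall 0 r = closedBall 0 r := by
    ext w
    simp [norm_smul, Circle.norm_coe]
  have := hc.setIntegral_preimage_emb hemb F (closedBall 0 r)
  rwa [hpre] at this

/-- The mean value property over balls of `ℂᵐ`. -/
lemma setIntegral_closedBall_of_differentiableOn {F : (Fin m → ℂ) → ℂ} {U : Set (Fin m → ℂ)}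
    (hU : IsOpen U) (hF : DifferentiableOn ℂ F U) {z : Fin m → ℂ} {r : ℝ}
    (hzU : closedBall z r ⊆ U) :
    ∫ w in closedBall 0 r, F (z + w) = (volume.real (closedBall (0 : Fin m → ℂ) r)) * F z := by
  have hmem (w : Fin m → ℂ) (hw : w ∈ closedBall 0 r) (l : ℂ) (hl : ‖l‖ ≤ 1) : z + l • w ∈ U := by
    apply hzU
    simp only [mem_closedBall, dist_self_add_left, norm_smul, dist_zero_right] at hw ⊢
    nlinarith [norm_nonneg w]
  -- One-variable mean value property on the disc `l ↦ z + l • w`; averaging over `w` then gives the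
  -- ball.
  have hcirc (w : Fin m → ℂ) (hw : w ∈ closedBall 0 r) :
      ∫ θ in (0 : ℝ)..2 * Real.pi, F (z + circleMap 0 1 θ • w) = 2 * Real.pi * F z := by
    have hd : DiffContOnCl ℂ (fun l : ℂ => F (z + l • w)) (ball 0 |1|) := by
      apply DifferentiableOn.diffContOnCl
      intro l hl
      rw [abs_one, closure_ball _ one_ne_zero] at hl
      have h1 : DifferentiableAt ℂ F (z + l • w) :=
        hF.differentiableAt (hU.mem_nhds (hmem w hw l (by simpa using hl)))
      have h2 : DifferentiableAt ℂ (fun l : ℂ => z + l • w) l := by fun_prop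
      exact (h1.comp l h2).differentiableWithinAt
    have := hd.circleAverage
    rw [Real.circleAverage_def] at this
    simp only [zero_smul, add_zero] at this
    rw [← this, Complex.real_smul]
    push_cast
    field_simp
  have hswap : ∫ w in closedBall (0 : Fin m → ℂ) r, ∫ θ in Set.Ioc (0 : ℝ) (2 * Real.pi),
        F (z + circleMap 0 1 θ • w) =
      ∫ θ in Set.Ioc (0 : ℝ) (2 * Real.pi), ∫ w in closedBall (0 : Fin m → ℂ) r,
        F (z + circleMap 0 1 θ • w) := by
    apply integral_integral_swap
    rw [Measure.prod_restrict]
    have hcont : ContinuousOn (fun p : (Fin m → ℂ) × ℝ => F (z + circleMap 0 1 p.2 • p.1))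
        (closedBall 0 r ×ˢ Set.Icc 0 (2 * Real.pi)) := by
      refine hF.continuousOn.comp (f := fun p : (Fin m → ℂ) × ℝ => z + circleMap 0 1 p.2 • p.1)
        (Continuous.continuousOn (by fun_prop)) fun p hp => hmem _ hp.1 _ (by simp)
    have hK : IsCompact (closedBall (0 : Fin m → ℂ) r ×ˢ Set.Icc (0 : ℝ) (2 * Real.pi)) :=
      (isCompact_closedBall _ _).prod isCompact_Icc
    exact (hcont.integrableOn_compact hK).mono_set (Set.prod_mono le_rfl Set.Ioc_subset_Icc_self)
  have hpi : (0 : ℝ) ≤ 2 * Real.pi := by positivity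
  have hL : ∫ w in closedBall (0 : Fin m → ℂ) r, ∫ θ in Set.Ioc (0 : ℝ) (2 * Real.pi),
        F (z + circleMap 0 1 θ • w) =
      volume.real (closedBall (0 : Fin m → ℂ) r) * (2 * Real.pi * F z) := by
    rw [setIntegral_congr_fun (g := fun _ => 2 * Real.pi * F z) isClosed_closedBall.measurableSet]
    · simp
    · intro w hw
      rw [← hcirc w hw, intervalIntegral.integral_of_le hpi]
  -- Rotation by a unimodular scalar preserves the ball and the measure, so the inner integral does
  -- not depend on `θ`.
  have hR (θ : ℝ) : ∫ w in closedBall (0 : Fin m → ℂ) r, F (z + circleMap 0 1 θ • w) =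
      ∫ w in closedBall 0 r, F (z + w) := by
    have := setIntegral_circle_smul (m := m) (fun w => F (z + w)) r (Circle.exp θ)
    simpa [circleMap] using this
  rw [hL] at hswap
  simp only [hR] at hswap
  rw [setIntegral_const] at hswap
  have h2 : (volume.real (Set.Ioc (0 : ℝ) (2 * Real.pi))) = 2 * Real.pi := by
    simp [hpi]
  rw [h2, Complex.real_smul] at hswap
  have h3 : ((2 * Real.pi : ℝ) : ℂ) ≠ 0 := by
    exact_mod_cast (by positivity : (2 * Real.pi : ℝ) ≠ 0)
  apply mul_left_cancel₀ h3
  rw [← hswap]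
  push_cast
  ring

end QuasiFreeRes

/-! ### Estimates of `𝒜(Ω)` in `L²(Ω)`. -/

namespace QuasiFreeRes

variable {m : ℕ} {Ω : Set (Fin m → ℂ)}

open MeasureTheory Filter Metric

/-- Lebesgue measure on `Ω`. -/
noncomputable abbrev lebesgueOn (Ω : Set (Fin m → ℂ)) : Measure Ω := volume.comap Subtype.val

lemma isFiniteMeasure_lebesgueOn (hopen : IsOpen Ω) (hbdd : Bornology.IsBounded Ω) :
    IsFiniteMeasure (lebesgueOn Ω) := by
  constructor
  rw [comap_subtype_coe_apply hopen.measurableSet]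
  simpa using hbdd.measure_lt_top

/-- The inclusion of `𝒜(Ω)` in `L²(Ω)`. -/
noncomputable def toL2 (Ω : Set (Fin m → ℂ)) [IsFiniteMeasure (lebesgueOn Ω)] :
    FunAlg Ω →L[ℂ] Lp ℂ 2 (lebesgueOn Ω) :=
  (BoundedContinuousFunction.toLp 2 (lebesgueOn Ω) ℂ).comp (FunAlg.incl Ω)

section

variable [IsFiniteMeasure (lebesgueOn Ω)]

lemma coeFn_toL2 (φ : FunAlg Ω) : toL2 Ω φ =ᵐ[lebesgueOn Ω] fun z => φ z :=
  BoundedContinuousFunction.coeFn_toLp 2 (lebesgueOn Ω) ℂ (FunAlg.incl Ω φ)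

lemma norm_toL2_mul_le (φ ψ : FunAlg Ω) : ‖toL2 Ω (φ * ψ)‖ ≤ ‖φ‖ * ‖toL2 Ω ψ‖ := by
  apply Lp.norm_le_mul_norm_of_ae_le_mul
  filter_upwards [coeFn_toL2 (φ * ψ), coeFn_toL2 ψ] with z h1 h2
  rw [h1, h2, FunAlg.mul_apply, norm_mul]
  exact mul_le_mul_of_nonneg_right (φ.norm_apply_le z) (norm_nonneg _)

/-- A subsequence converges almost everywhere to `G`, and the pointwise limit is `0`. This
identifies limits in the completed free module through point evaluations. -/
lemma eq_zero_of_tendsto_toL2 {ψ : ℕ → FunAlg Ω} {G : Lp ℂ 2 (lebesgueOn Ω)}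
    (hG : Tendsto (fun n => toL2 Ω (ψ n)) atTop (𝓝 G))
    (hψ : ∀ z, Tendsto (fun n => ψ n z) atTop (𝓝 0)) : G = 0 := by
  obtain ⟨ns, hns, hae⟩ := (tendstoInMeasure_of_tendsto_Lp hG).exists_seq_tendsto_ae
  have hall : ∀ᵐ z ∂lebesgueOn Ω, ∀ n, toL2 Ω (ψ n) z = ψ n z :=
    ae_all_iff.2 fun n => coeFn_toL2 (ψ n)
  apply Lp.ext
  filter_upwards [hae, hall, Lp.coeFn_zero ℂ 2 (lebesgueOn Ω)] with z h1 h2 h3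
  rw [h3]
  simp only [h2] at h1
  exact tendsto_nhds_unique h1 ((hψ z).comp hns.tendsto_atTop)

lemma integral_norm_le_toL2 (φ : FunAlg Ω) :
    ∫ z, ‖φ z‖ ∂lebesgueOn Ω ≤ √((lebesgueOn Ω).real Set.univ) * ‖toL2 Ω φ‖ := by
  have hae : eLpNorm (toL2 Ω φ) 1 (lebesgueOn Ω) = eLpNorm (fun z => φ z) 1 (lebesgueOn Ω) :=
    eLpNorm_congr_ae (coeFn_toL2 φ)
  have hcont : Continuous fun z => φ z := (FunAlg.incl Ω φ).continuous
  have h1 : ∫ z, ‖φ z‖ ∂lebesgueOn Ω = (eLpNorm (toL2 Ω φ) 1 (lebesgueOn Ω)).toReal := by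
    rw [hae, eLpNorm_one_eq_lintegral_enorm, integral_norm_eq_lintegral_enorm
      hcont.aestronglyMeasurable]
  have h2 := eLpNorm_le_eLpNorm_mul_rpow_measure_univ (μ := (lebesgueOn Ω)) (p := 1) (q := 2)
    (f := toL2 Ω φ) (by norm_num) (Lp.aestronglyMeasurable _)
  rw [h1, mul_comm, Lp.norm_def, Real.sqrt_eq_rpow, measureReal_def, ENNReal.toReal_rpow,
    ← ENNReal.toReal_mul]
  refine ENNReal.toReal_mono ?_ (h2.trans_eq ?_)
  · exact ENNReal.mul_ne_top (Lp.eLpNorm_ne_top _) (by simp)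
  · norm_num

/-- Point evaluations are bounded for the `L²` norm, locally uniformly. -/
lemma exists_norm_apply_le_toL2 (hopen : IsOpen Ω) (z₀ : Ω) :
    ∃ C : ℝ, 0 ≤ C ∧ ∀ᶠ z in 𝓝 z₀, ∀ φ : FunAlg Ω, ‖φ z‖ ≤ C * ‖toL2 Ω φ‖ := by
  obtain ⟨ε, hε, hball⟩ := Metric.isOpen_iff.1 hopen z₀ z₀.2
  -- Half the radius: every `z` within `r` of `z₀` has its closed `r`-ball inside `Ω`, so one
  -- constant serves all of them.
  set r := ε / 2 with hr
  have hr0 : 0 < r := by positivity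
  set V := volume.real (closedBall (0 : Fin m → ℂ) r) with hV
  have hV0 : 0 < V := by
    refine ENNReal.toReal_pos ?_ ?_
    · exact (measure_closedBall_pos _ _ hr0).ne'
    · exact measure_closedBall_lt_top.ne
  -- The factor `V⁻¹` comes from the mean value over the ball, the root from comparing the `L¹` and
  -- `L²` norms.
  refine ⟨V⁻¹ * √((lebesgueOn Ω).real Set.univ), by positivity, ?_⟩
  filter_upwards [Metric.ball_mem_nhds z₀ hr0] with z hz
  have hsub : closedBall (z : Fin m → ℂ) r ⊆ Ω := by
    intro w hw
    apply hball
    have hz' : dist (z : Fin m → ℂ) z₀ < r := hz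
    rw [mem_closedBall] at hw
    rw [mem_ball]
    linarith [dist_triangle w z z₀]
  refine FunAlg.induction_closed ?_ ?_
  · exact isClosed_le (FunAlg.evalCLM z).continuous.norm
      (continuous_const.mul (toL2 Ω).continuous.norm)
  · intro φ U F hU hΩU hF hφF
    have hmean := setIntegral_closedBall_of_differentiableOn hU hF
      (hsub.trans (subset_closure.trans hΩU))
    have hshift : ∫ w in closedBall 0 r, ‖F (z + w)‖ =
        ∫ w in closedBall (z : Fin m → ℂ) r, ‖F w‖ := by
      have := (measurePreserving_add_left volume (z : Fin m → ℂ)).setIntegral_preimage_emb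
        (measurableEmbedding_addLeft _) (fun w => ‖F w‖) (closedBall (z : Fin m → ℂ) r)
      rw [← this]
      simp
    have hΩint : ∫ w in Ω, ‖F w‖ = ∫ z, ‖φ z‖ ∂lebesgueOn Ω := by
      rw [← integral_subtype_comap hopen.measurableSet]
      exact integral_congr_ae (Eventually.of_forall fun z => by simp [hφF])
    have hint : IntegrableOn (fun w => ‖F w‖) Ω := by
      rw [integrableOn_iff_comap_subtypeVal hopen.measurableSet]
      have : Integrable (fun z : Ω => ‖φ z‖) (lebesgueOn Ω) := by
        refine Integrable.norm ?_
        exact (FunAlg.incl Ω φ).integrable (lebesgueOn Ω)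
      exact this.congr (Eventually.of_forall fun z => by simp [hφF])
    have hle : V * ‖φ z‖ ≤ ∫ z, ‖φ z‖ ∂lebesgueOn Ω := by
      rw [hφF, ← hΩint]
      calc V * ‖F z‖ = ‖∫ w in closedBall 0 r, F (z + w)‖ := by
            rw [hmean, norm_mul, Complex.norm_real, Real.norm_of_nonneg hV0.le]
        _ ≤ ∫ w in closedBall 0 r, ‖F (z + w)‖ := norm_integral_le_integral_norm _
        _ = ∫ w in closedBall (z : Fin m → ℂ) r, ‖F w‖ := hshift
        _ ≤ ∫ w in Ω, ‖F w‖ := setIntegral_mono_set hint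
            (Eventually.of_forall fun _ => norm_nonneg _) (LE.le.eventuallyLE hsub)
    have := hle.trans (integral_norm_le_toL2 φ)
    rw [mul_assoc, ← div_eq_inv_mul, le_div_iff₀ hV0, mul_comm]
    exact this

/-- The supremum norm over a compact subset of `Ω` is dominated by the `L²` norm. -/
lemma exists_supNormOn_le_toL2 (hopen : IsOpen Ω) {X : Set Ω} (hX : IsCompact X) :
    ∃ C : ℝ, 0 ≤ C ∧ ∀ φ : FunAlg Ω, supNormOn X φ ≤ C * ‖toL2 Ω φ‖ := by
  suffices h : ∃ C : ℝ, 0 ≤ C ∧ ∀ z ∈ X, ∀ φ : FunAlg Ω, ‖φ z‖ ≤ C * ‖toL2 Ω φ‖ by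
    obtain ⟨C, hC, h⟩ := h
    exact ⟨C, hC, fun φ => Real.iSup_le (fun z => h z z.2 φ) (by positivity)⟩
  refine hX.induction_on (p := fun X => ∃ C : ℝ, 0 ≤ C ∧ ∀ z ∈ X, ∀ φ : FunAlg Ω,
    ‖φ z‖ ≤ C * ‖toL2 Ω φ‖) ⟨0, le_rfl, by simp⟩ ?_ ?_ ?_
  · rintro s t hst ⟨C, hC, h⟩
    exact ⟨C, hC, fun z hz => h z (hst hz)⟩
  · rintro s t ⟨C, hC, h⟩ ⟨D, hD, h'⟩
    refine ⟨max C D, hC.trans (le_max_left _ _), ?_⟩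
    rintro z (hz | hz) φ
    · exact (h z hz φ).trans (mul_le_mul_of_nonneg_right (le_max_left _ _) (norm_nonneg _))
    · exact (h' z hz φ).trans (mul_le_mul_of_nonneg_right (le_max_right _ _) (norm_nonneg _))
  · intro z hz
    obtain ⟨C, hC, h⟩ := exists_norm_apply_le_toL2 hopen z
    exact ⟨_, mem_nhdsWithin_of_mem_nhds h, C, hC, fun z hz => hz⟩

end

end QuasiFreeRes

/-! ### Fibres, boundedness of the action, and `ℓ²` sums. -/

namespace QuasiFreeRes

variable {m : ℕ} {Ω : Set (Fin m → ℂ)}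

open MeasureTheory Filter

section Fiber

variable {M : HilbertModule.{u} Ω}

/-- The localization map `f ↦ f ⊗ 1_z` as a continuous linear map. -/
noncomputable def locCLM (M : HilbertModule.{u} Ω) (z : Ω) : M →L[ℂ] Fiber M z :=
  (fiberRel M z).mkQL.comp ((TensorProduct.mkL ℂ M ℂ).flip 1)

lemma locCLM_apply (z : Ω) (f : M) : locCLM M z f = loc z f := rfl

lemma loc_smul (z : Ω) (φ : FunAlg Ω) (f : M) : loc z (φ • f) = φ z • loc z f := by
  rw [← sub_eq_zero]
  have : φ z • loc z f = (fiberRel M z).mkQ (f ⊗ₜ[ℂ] (φ z * 1)) := by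
    rw [loc, ← map_smul, ← TensorProduct.tmul_smul, smul_eq_mul]
  rw [this, loc, ← map_sub, Submodule.mkQ_apply, Submodule.Quotient.mk_eq_zero]
  exact Submodule.le_topologicalClosure _ (Submodule.subset_span ⟨φ, f, 1, rfl⟩)

lemma norm_fiber_zero (z : Ω) : ‖(0 : Fiber M z)‖ = 0 := norm_zero (E := Fiber M z)

lemma loc_surjective (z : Ω) : Function.Surjective (loc z : M → Fiber M z) := by
  intro x
  obtain ⟨y, rfl⟩ := Submodule.mkQ_surjective _ x
  refine ⟨TensorProduct.rid ℂ M y, ?_⟩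
  rw [loc]
  congr 1
  exact (TensorProduct.rid ℂ M).symm_apply_apply y

/-- A bounded map that intertwines the module action with evaluation at `z` factors boundedly
through the fibre at `z`. -/
lemma norm_le_mul_norm_loc {W : Type*} [NormedAddCommGroup W] [NormedSpace ℂ W] {z : Ω}
    (L : M →L[ℂ] W) (hL : ∀ (φ : FunAlg Ω) (f : M), L (φ • f) = φ z • L f) {C : ℝ} (hC : 0 ≤ C)
    (hLC : ∀ f, ‖L f‖ ≤ C * ‖f‖) (f : M) : ‖L f‖ ≤ C * ‖loc z f‖ := by
  let L' : M ⊗[ℂ] ℂ →L[ℂ] W :=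
    L.comp (TensorProduct.ridIsometry ℂ M).toContinuousLinearEquiv.toContinuousLinearMap
  have hL' (g : M) (a : ℂ) : L' (g ⊗ₜ a) = a • L g := by
    simp [L']
  have hker : fiberRel M z ≤ LinearMap.ker L'.toLinearMap := by
    refine Submodule.topologicalClosure_minimal _ (Submodule.span_le.2 ?_) L'.isClosed_ker
    rintro _ ⟨φ, g, a, rfl⟩
    simp only [SetLike.mem_coe, LinearMap.mem_ker, ContinuousLinearMap.coe_coe, map_sub, hL', hL,
      smul_smul]
    rw [mul_comm, sub_self]
  refine le_of_forall_pos_le_add fun ε hε => ?_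
  -- The quotient norm is an infimum over representatives; the slack `ε / (C + 1)` costs at most `ε`
  -- after multiplication by `C`, even if `C = 0`.
  obtain ⟨y, hy, hlt⟩ := Submodule.Quotient.norm_mk_lt (loc z f) (ε := ε / (C + 1)) (by positivity)
  have hyf : L f = L' y := by
    have h1 : y - f ⊗ₜ 1 ∈ fiberRel M z := (Submodule.Quotient.eq _).1 hy
    have h2 : L' (y - f ⊗ₜ 1) = 0 := hker h1
    rw [map_sub, sub_eq_zero, hL', one_smul] at h2
    exact h2.symm
  have hy' : ‖L' y‖ ≤ C * ‖y‖ := by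
    refine (hLC _).trans_eq ?_
    congr 1
    exact (TensorProduct.ridIsometry ℂ M).norm_map y
  have h3 : C * (ε / (C + 1)) ≤ ε := by
    rw [← mul_div_assoc, div_le_iff₀ (by positivity)]
    nlinarith
  rw [hyf]
  nlinarith [mul_le_mul_of_nonneg_left hlt.le hC]

end Fiber

/-- Joint continuity at the origin makes products of vectors shorter than `δ` shorter than `1`;
rescaling both factors to length `δ / 2` gives the constant `(2 / δ)²`. -/
lemma HilbertModule.exists_norm_smul_le (M : HilbertModule.{u} Ω) :
    ∃ C : ℝ, 0 ≤ C ∧ ∀ (φ : FunAlg Ω) (f : M), ‖φ • f‖ ≤ C * ‖φ‖ * ‖f‖ := by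
  let B : FunAlg Ω →ₗ[ℂ] M →ₗ[ℂ] M := (Algebra.lsmul ℂ ℂ (M : Type u)).toLinearMap
  have hcont : Continuous fun p : FunAlg Ω × M => B p.1 p.2 := continuous_smul
  have h0 := hcont.tendsto (0, 0)
  simp only [map_zero] at h0
  obtain ⟨δ, hδ, h⟩ := Metric.tendsto_nhds_nhds.1 h0 1 one_pos
  have hsmall (φ : FunAlg Ω) (f : M) (hφ : ‖φ‖ < δ) (hf : ‖f‖ < δ) : ‖φ • f‖ < 1 := by
    have := @h (φ, f) (by simpa [Prod.dist_eq] using ⟨hφ, hf⟩)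
    simpa [B] using this
  refine ⟨(2 / δ) * (2 / δ), by positivity, fun φ f => ?_⟩
  rcases eq_or_ne φ 0 with rfl | hφ
  · simp
  rcases eq_or_ne f 0 with rfl | hf
  · simp
  have hφ0 : 0 < ‖φ‖ := norm_pos_iff.2 hφ
  have hf0 : 0 < ‖f‖ := norm_pos_iff.2 hf
  have key (a : ℝ) (ha : 0 < a) : ‖((δ / 2 / a : ℝ) : ℂ)‖ * a < δ := by
    rw [Complex.norm_real, Real.norm_of_nonneg (by positivity), div_mul_cancel₀ _ ha.ne']
    linarith
  have h1 := hsmall (((δ / 2 / ‖φ‖ : ℝ) : ℂ) • φ) (((δ / 2 / ‖f‖ : ℝ) : ℂ) • f)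
    (by rw [norm_smul]; exact key _ hφ0) (by rw [norm_smul]; exact key _ hf0)
  have h2 : (((δ / 2 / ‖φ‖ : ℝ) : ℂ) • φ) • (((δ / 2 / ‖f‖ : ℝ) : ℂ) • f) =
      ((δ / 2 / ‖φ‖ : ℝ) : ℂ) • ((δ / 2 / ‖f‖ : ℝ) : ℂ) • (φ • f) := by
    rw [smul_assoc]
    congr 1
    exact (B φ).map_smul _ f
  rw [h2, norm_smul, norm_smul, Complex.norm_real, Complex.norm_real,
    Real.norm_of_nonneg (by positivity), Real.norm_of_nonneg (by positivity)] at h1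
  have h3 : δ / 2 / ‖φ‖ * (δ / 2 / ‖f‖ * ‖φ • f‖) =
      ‖φ • f‖ / (2 / δ * (2 / δ) * ‖φ‖ * ‖f‖) := by
    field_simp
  rw [h3, div_lt_one (by positivity)] at h1
  exact h1.le

section L2Sum

variable {ι : Type*} {V : Type*} [NormedAddCommGroup V] {V' : Type*} [NormedAddCommGroup V']

lemma lp_two_norm_le_mul {x : lp (fun _ : ι => V) 2} {y : lp (fun _ : ι => V') 2} {C : ℝ}
    (hC : 0 ≤ C) (h : ∀ i, ‖x i‖ ≤ C * ‖y i‖) : ‖x‖ ≤ C * ‖y‖ := by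
  refine lp.norm_le_of_forall_sum_le (by norm_num) (by positivity) fun s => ?_
  calc ∑ i ∈ s, ‖x i‖ ^ (2 : ENNReal).toReal
      ≤ ∑ i ∈ s, C ^ (2 : ENNReal).toReal * ‖y i‖ ^ (2 : ENNReal).toReal := by
        refine Finset.sum_le_sum fun i _ => ?_
        rw [← Real.mul_rpow hC (norm_nonneg _)]
        exact Real.rpow_le_rpow (norm_nonneg _) (h i) (by norm_num)
    _ = C ^ (2 : ENNReal).toReal * ∑ i ∈ s, ‖y i‖ ^ (2 : ENNReal).toReal := by
        rw [Finset.mul_sum]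
    _ ≤ C ^ (2 : ENNReal).toReal * ‖y‖ ^ (2 : ENNReal).toReal :=
        mul_le_mul_of_nonneg_left (lp.sum_rpow_le_norm_rpow (by norm_num) y s)
          (Real.rpow_nonneg hC _)
    _ = (C * ‖y‖) ^ (2 : ENNReal).toReal := (Real.mul_rpow hC (norm_nonneg _)).symm

lemma sqrt_sum_le_lp_two_norm (x : lp (fun _ : ι => V) 2) (s : Finset ι) :
    √(∑ i ∈ s, ‖x i‖ ^ 2) ≤ ‖x‖ := by
  rw [Real.sqrt_le_left (norm_nonneg _)]
  have := lp.sum_rpow_le_norm_rpow (p := 2) (by norm_num) x s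
  simpa using this

variable [NormedSpace ℂ V]

/-- The coordinatewise extension of a linear map to finitely supported families, with values in the
`ℓ²` sum. -/
noncomputable def finsuppToLp (ι : Type*) (S : FunAlg Ω →ₗ[ℂ] V) :
    (ι →₀ FunAlg Ω) →ₗ[ℂ] lp (fun _ : ι => V) 2 where
  toFun Φ := ⟨fun i => S (Φ i), by
    refine (memℓp_zero ?_).of_exponent_ge zero_le
    refine Φ.support.finite_toSet.subset fun i hi => ?_
    simp only [Set.mem_ofPred_eq] at hi
    simp only [Finset.mem_coe, Finsupp.mem_support_iff]
    rintro h
    exact hi (by rw [h, map_zero])⟩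
  map_add' Φ Ψ := by
    ext i
    exact map_add S (Φ i) (Ψ i)
  map_smul' c Φ := by
    ext i
    exact map_smul S c (Φ i)

end L2Sum

end QuasiFreeRes

/-! ### The free module with the graph norm and its completion. -/

namespace QuasiFreeRes

variable {m : ℕ} {Ω : Set (Fin m → ℂ)}

open MeasureTheory Filter UniformSpace

section Construction

variable {M : HilbertModule.{u} Ω} {ι : Type u}

/-- The algebraic free `𝒜(Ω)`-module on `ι`, to be normed by means of the family `f` in `M`. -/
def PreFree (_f : ι → M) : Type u := ι →₀ FunAlg Ω

namespace PreFree

noncomputable instance (f : ι → M) : AddCommGroup (PreFree f) :=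
  inferInstanceAs (AddCommGroup (ι →₀ FunAlg Ω))

noncomputable instance (f : ι → M) : Module (FunAlg Ω) (PreFree f) :=
  inferInstanceAs (Module (FunAlg Ω) (ι →₀ FunAlg Ω))

noncomputable instance (f : ι → M) : Module ℂ (PreFree f) :=
  inferInstanceAs (Module ℂ (ι →₀ FunAlg Ω))

instance (f : ι → M) : IsScalarTower ℂ (FunAlg Ω) (PreFree f) :=
  inferInstanceAs (IsScalarTower ℂ (FunAlg Ω) (ι →₀ FunAlg Ω))

/-- The module map `Φ ↦ ∑ Φᵢ fᵢ`. -/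
noncomputable def comb (f : ι → M) : PreFree f →ₗ[FunAlg Ω] M :=
  Finsupp.linearCombination (FunAlg Ω) f

/-- The `i`-th generator. -/
noncomputable def gen (f : ι → M) (i : ι) : PreFree f := Finsupp.single i (1 : FunAlg Ω)

lemma span_range_gen (f : ι → M) : Submodule.span (FunAlg Ω) (Set.range (gen f)) = ⊤ :=
  (Finsupp.basisSingleOne (R := FunAlg Ω) (ι := ι)).span_eq

/-- Coordinatewise evaluation at `z`. -/
noncomputable def eval (f : ι → M) (z : Ω) : PreFree f →ₗ[ℂ] lp (fun _ : ι => ℂ) 2 :=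
  finsuppToLp ι (FunAlg.evalCLM z).toLinearMap

lemma eval_smul (f : ι → M) (z : Ω) (φ : FunAlg Ω) (x : PreFree f) :
    eval f z (φ • x) = φ z • eval f z x := by
  ext i
  rfl

lemma eval_sum_gen (f : ι → M) (z : Ω) (c : ι →₀ ℂ) (i : ι) :
    eval f z (c.sum fun i a => a • gen f i) i = c i := by
  classical
  rw [Finsupp.sum, map_sum, lp.coeFn_sum, Finset.sum_apply]
  have (j : ι) : eval f z (c j • gen f j) i = if j = i then c j else 0 := by
    rw [map_smul]
    change c j * (Finsupp.single j (1 : FunAlg Ω) i) z = _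
    split_ifs with h
    · subst h
      simp
    · rw [Finsupp.single_eq_of_ne (Ne.symm h)]
      simp
  simp only [this, Finset.sum_ite_eq', Finsupp.mem_support_iff]
  exact ite_eq_left_iff.2 fun h => (not_not.1 h).symm

variable [IsFiniteMeasure (lebesgueOn Ω)]

/-- The inclusion of the finitely supported families in the `ℓ²` sum of copies of `L²(Ω)`. -/
noncomputable def l2 (f : ι → M) : PreFree f →ₗ[ℂ] lp (fun _ : ι => Lp ℂ 2 (lebesgueOn Ω)) 2 :=
  finsuppToLp ι (toL2 Ω).toLinearMap

/-- The inner product of the graph of `comb f` over the `ℓ²` sum of copies of `L²(Ω)`. -/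
noncomputable abbrev core (f : ι → M) : PreInnerProductSpace.Core ℂ (PreFree f) where
  -- The first summand keeps evaluations bounded, the second keeps `comb f` bounded. Definiteness is
  -- not needed, since the completion is separated.
  inner x y := inner ℂ (l2 f x) (l2 f y) + inner ℂ (comb f x) (comb f y)
  conj_inner_symm x y := by simp
  re_inner_nonneg x := by
    rw [map_add]
    exact add_nonneg inner_self_nonneg inner_self_nonneg
  add_left x y z := by
    simp only [map_add, inner_add_left]
    ring
  smul_left x y c := by
    have : comb f (c • x) = c • comb f x := ((comb f).restrictScalars ℂ).map_smul c x
    rw [this, map_smul, inner_smul_left, inner_smul_left]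
    ring

noncomputable instance (f : ι → M) : SeminormedAddCommGroup (PreFree f) :=
  @InnerProductSpace.Core.toSeminormedAddCommGroup ℂ (PreFree f) _ _ _ (core f)

noncomputable instance (f : ι → M) : InnerProductSpace ℂ (PreFree f) :=
  InnerProductSpace.ofCore (core f)

lemma norm_sq (f : ι → M) (x : PreFree f) : ‖x‖ ^ 2 = ‖l2 f x‖ ^ 2 + ‖comb f x‖ ^ 2 := by
  rw [norm_sq_eq_re_inner (𝕜 := ℂ) x, norm_sq_eq_re_inner (𝕜 := ℂ) (l2 f x),
    norm_sq_eq_re_inner (𝕜 := ℂ) (comb f x), ← map_add]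
  rfl

lemma norm_l2_le (f : ι → M) (x : PreFree f) : ‖l2 f x‖ ≤ ‖x‖ :=
  abs_le_of_sq_le_sq' (by nlinarith [norm_sq f x, sq_nonneg ‖comb f x‖]) (norm_nonneg _) |>.2

lemma norm_comb_le (f : ι → M) (x : PreFree f) : ‖comb f x‖ ≤ ‖x‖ :=
  abs_le_of_sq_le_sq' (by nlinarith [norm_sq f x, sq_nonneg ‖l2 f x‖]) (norm_nonneg _) |>.2

lemma norm_le (f : ι → M) (x : PreFree f) : ‖x‖ ≤ ‖l2 f x‖ + ‖comb f x‖ := by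
  refine abs_le_of_sq_le_sq' ?_ (by positivity) |>.2
  nlinarith [norm_sq f x, mul_nonneg (norm_nonneg (l2 f x)) (norm_nonneg (comb f x))]

lemma norm_l2_smul_le (f : ι → M) (φ : FunAlg Ω) (x : PreFree f) :
    ‖l2 f (φ • x)‖ ≤ ‖φ‖ * ‖l2 f x‖ :=
  lp_two_norm_le_mul (norm_nonneg _) fun _ => norm_toL2_mul_le _ _

lemma exists_norm_smul_le (f : ι → M) :
    ∃ C : ℝ, 0 ≤ C ∧ ∀ (φ : FunAlg Ω) (x : PreFree f), ‖φ • x‖ ≤ C * ‖φ‖ * ‖x‖ := by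
  obtain ⟨C, hC, h⟩ := M.exists_norm_smul_le
  refine ⟨1 + C, by positivity, fun φ x => ?_⟩
  refine (norm_le f _).trans ?_
  rw [map_smul (comb f)]
  have h1 := (norm_l2_smul_le f φ x).trans
    (mul_le_mul_of_nonneg_left (norm_l2_le f x) (norm_nonneg φ))
  have h2 := (h φ (comb f x)).trans
    (mul_le_mul_of_nonneg_left (norm_comb_le f x) (by positivity))
  linarith

instance (f : ι → M) : UniformContinuousConstSMul (FunAlg Ω) (PreFree f) where
  uniformContinuous_const_smul φ := by
    obtain ⟨C, hC, h⟩ := exists_norm_smul_le f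
    exact AddMonoidHomClass.uniformContinuous_of_bound
      (DistribSMul.toAddMonoidHom (PreFree f) φ) (C * ‖φ‖) (h φ)

lemma norm_eval_le (f : ι → M) {z : Ω} {C : ℝ} (hC : 0 ≤ C)
    (h : ∀ φ : FunAlg Ω, ‖φ z‖ ≤ C * ‖toL2 Ω φ‖) (x : PreFree f) : ‖eval f z x‖ ≤ C * ‖l2 f x‖ :=
  lp_two_norm_le_mul hC fun _ => h _

end PreFree

variable [IsFiniteMeasure (lebesgueOn Ω)]

/-- The bilinear estimate of the action on the free module passes to the completion by density. -/
instance (f : ι → M) : ContinuousSMul (FunAlg Ω) (Completion (PreFree f)) := by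
  obtain ⟨C, hC, h⟩ := PreFree.exists_norm_smul_le f
  have h' (φ : FunAlg Ω) (x : Completion (PreFree f)) : ‖φ • x‖ ≤ C * ‖φ‖ * ‖x‖ := by
    induction x using Completion.induction_on with
    | hp => exact isClosed_le (continuous_const_smul φ).norm (continuous_const.mul continuous_norm)
    | ih x =>
      rw [← Completion.coe_smul, Completion.norm_coe, Completion.norm_coe]
      exact h φ x
  have hb : IsBoundedBilinearMap ℂ fun p : FunAlg Ω × Completion (PreFree f) => p.1 • p.2 :=
    { add_left := fun _ _ _ => add_smul _ _ _
      smul_left := fun _ _ _ => smul_assoc _ _ _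
      add_right := fun _ _ _ => smul_add _ _ _
      smul_right := fun c φ x => smul_comm φ c x
      bound := ⟨C + 1, by positivity, fun φ x => (h' φ x).trans (by gcongr; linarith)⟩ }
  exact ⟨hb.continuous⟩

/-- The completion of the free module on `ι` in the graph norm defined by the family `f`. -/
noncomputable def freeCompletion (f : ι → M) : HilbertModule.{u} Ω where
  carrier := Completion (PreFree f)

end Construction

end QuasiFreeRes

/-! ### Closable families give quasi-free modules. -/

namespace QuasiFreeRes

variable {m : ℕ} {Ω : Set (Fin m → ℂ)}

open MeasureTheory Filter UniformSpace

variable {M : HilbertModule.{u} Ω} {ι : Type u} [IsFiniteMeasure (lebesgueOn Ω)]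

/-- The map `Φ ↦ ∑ Φᵢ fᵢ` is closable for the `ℓ²` sum of `L²(Ω)` norms. -/
def IsClosableFamily (f : ι → M) : Prop :=
  ∀ (Φ : ℕ → PreFree f) (h : M), Tendsto (fun n => PreFree.l2 f (Φ n)) atTop (𝓝 0) →
    Tendsto (fun n => PreFree.comb f (Φ n)) atTop (𝓝 h) → h = 0

namespace freeCompletion

/-- The inclusion of the free module in its completion. -/
noncomputable def coe (f : ι → M) (x : PreFree f) : freeCompletion f := (x : Completion (PreFree f))

lemma coe_add (f : ι → M) (x y : PreFree f) : coe f (x + y) = coe f x + coe f y :=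
  Completion.coe_add x y

lemma coe_smul (f : ι → M) (φ : FunAlg Ω) (x : PreFree f) : coe f (φ • x) = φ • coe f x :=
  Completion.coe_smul φ x

lemma norm_coe (f : ι → M) (x : PreFree f) : ‖coe f x‖ = ‖x‖ := Completion.norm_coe x

lemma denseRange_coe (f : ι → M) : DenseRange (coe f) := Completion.denseRange_coe

/-- The inclusion as a module map. -/
noncomputable def coeₗ (f : ι → M) : PreFree f →ₗ[FunAlg Ω] freeCompletion f where
  toFun := coe f
  map_add' := coe_add f
  map_smul' := coe_smul f

/-- The extension of `∑ Φᵢ fᵢ` to the completion. -/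
noncomputable def toModule (f : ι → M) : freeCompletion f →L[FunAlg Ω] M :=
  haveI : UniformContinuousConstSMul (FunAlg Ω) M :=
    uniformContinuousConstSMul_of_continuousConstSMul _ _
  ContinuousLinearMap.fromCompletion (α := PreFree f)
    ⟨PreFree.comb f, AddMonoidHomClass.continuous_of_bound (PreFree.comb f) 1 fun x => by
      simpa using PreFree.norm_comb_le f x⟩

lemma toModule_coe (f : ι → M) (x : PreFree f) : toModule f (coe f x) = PreFree.comb f x :=
  haveI : UniformContinuousConstSMul (FunAlg Ω) M :=
    uniformContinuousConstSMul_of_continuousConstSMul _ _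
  ContinuousLinearMap.fromCompletion_apply_coe (α := PreFree f) _ x

/-- Coordinatewise evaluation at `z` on the completion. -/
lemma exists_eval (f : ι → M) {z : Ω} {C : ℝ} (hC : 0 ≤ C)
    (h : ∀ φ : FunAlg Ω, ‖φ z‖ ≤ C * ‖toL2 Ω φ‖) :
    ∃ L : freeCompletion f →L[ℂ] lp (fun _ : ι => ℂ) 2,
      (∀ x, L (coe f x) = PreFree.eval f z x) ∧ (∀ g, ‖L g‖ ≤ C * ‖g‖) ∧
      ∀ (φ : FunAlg Ω) (g : freeCompletion f), L (φ • g) = φ z • L g := by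
  have hb (x : PreFree f) : ‖PreFree.eval f z x‖ ≤ C * ‖x‖ :=
    (PreFree.norm_eval_le f hC h x).trans (mul_le_mul_of_nonneg_left (PreFree.norm_l2_le f x) hC)
  let L₀ : PreFree f →L[ℂ] lp (fun _ : ι => ℂ) 2 := (PreFree.eval f z).mkContinuous C hb
  let L : freeCompletion f →L[ℂ] lp (fun _ : ι => ℂ) 2 :=
    ContinuousLinearMap.fromCompletion (α := PreFree f) L₀
  have hL (x) : L (coe f x) = PreFree.eval f z x :=
    ContinuousLinearMap.fromCompletion_apply_coe (α := PreFree f) L₀ x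
  refine ⟨L, hL, fun g => ?_, fun φ g => ?_⟩
  · refine (denseRange_coe f).induction_on g
      (isClosed_le L.continuous.norm (continuous_const.mul continuous_norm)) fun x => ?_
    rw [hL, norm_coe]
    exact hb x
  · refine (denseRange_coe f).induction_on g
      (isClosed_eq (L.continuous.comp (continuous_const_smul φ))
        (L.continuous.const_smul (φ z))) fun x => ?_
    rw [← coe_smul, hL, hL, PreFree.eval_smul]

/-- The generators of the completion. -/
noncomputable def gen (f : ι → M) (i : ι) : freeCompletion f := coe f (PreFree.gen f i)

lemma span_range_gen (f : ι → M) :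
    (Submodule.span (FunAlg Ω) (Set.range (gen f)) : Set (freeCompletion f)) =
      Set.range (coe f) := by
  have h1 : Set.range (gen f) = coeₗ f '' Set.range (PreFree.gen f) := by
    rw [← Set.range_comp]
    rfl
  rw [h1, ← Submodule.map_span, PreFree.span_range_gen, Submodule.map_top]
  rfl

lemma closure_range_toModule (f : ι → M) :
    closure (Set.range (toModule f)) =
      closure (Submodule.span (FunAlg Ω) (Set.range f) : Set M) := by
  have h1 : (Submodule.span (FunAlg Ω) (Set.range f) : Set M) =
      toModule f '' Set.range (coe f) := by
    rw [← Set.range_comp]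
    have : ⇑(toModule f) ∘ coe f = PreFree.comb f := funext (toModule_coe f)
    rw [this]
    exact congrArg (fun S : Submodule (FunAlg Ω) M => (S : Set M))
      (Finsupp.range_linearCombination (FunAlg Ω)).symm
  rw [h1]
  refine subset_antisymm ?_ (closure_mono (Set.image_subset_range _ _))
  refine closure_minimal ?_ isClosed_closure
  rw [← Set.image_univ, ← (denseRange_coe f).closure_range]
  exact image_closure_subset_closure_image (toModule f).continuous

/-- Evaluation factors through the fibres, so the coordinates of an approximating sequence tend to
`0` pointwise and its `ℓ²`-sum limit is `0`. Closability then removes the remaining part of the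
graph norm. -/
lemma eq_zero_of_forall_loc_eq_zero (hopen : IsOpen Ω) {f : ι → M} (hf : IsClosableFamily f)
    {g : freeCompletion f} (hg : ∀ z, loc z g = 0) : g = 0 := by
  obtain ⟨x, hx⟩ : ∃ x : ℕ → PreFree f, Tendsto (fun n => coe f (x n)) atTop (𝓝 g) := by
    obtain ⟨y, hy, hlim⟩ := mem_closure_iff_seq_limit.1 (denseRange_coe f g)
    choose x hx using hy
    exact ⟨x, by simpa only [hx] using hlim⟩
  have hpt (z : Ω) (i : ι) : Tendsto (fun n => (show ι →₀ FunAlg Ω from x n) i z) atTop (𝓝 0) := by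
    obtain ⟨C, hC, hev⟩ := exists_norm_apply_le_toL2 hopen z
    obtain ⟨L, hL, hLC, hLφ⟩ := exists_eval f hC hev.self_of_nhds
    have hLg : L g = 0 := by
      have := norm_le_mul_norm_loc L hLφ hC hLC g
      rw [hg z, norm_fiber_zero, mul_zero] at this
      exact norm_le_zero_iff.1 this
    have h1 := (L.continuous.tendsto g).comp hx
    rw [hLg, tendsto_zero_iff_norm_tendsto_zero] at h1
    refine squeeze_zero_norm (fun n => ?_) h1
    simp only [Function.comp_apply, hL]
    exact lp.norm_apply_le_norm two_ne_zero (PreFree.eval f z (x n)) i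
  have hcauchy : CauchySeq x := by
    have := hx.cauchySeq
    rw [Metric.cauchySeq_iff'] at this ⊢
    intro ε hε
    obtain ⟨N, hN⟩ := this ε hε
    refine ⟨N, fun n hn => ?_⟩
    have h2 := hN n hn
    rwa [show dist (coe f (x n)) (coe f (x N)) = dist (x n) (x N) from
      Completion.dist_eq (x n) (x N)] at h2
  let J : PreFree f →L[ℂ] lp (fun _ : ι => Lp ℂ 2 (lebesgueOn Ω)) 2 :=
    (PreFree.l2 f).mkContinuous 1 fun y => by simpa using PreFree.norm_l2_le f y
  obtain ⟨G, hG⟩ := cauchySeq_tendsto_of_complete (J.uniformContinuous.comp_cauchySeq hcauchy)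
  have hG' : Tendsto (fun n => PreFree.l2 f (x n)) atTop (𝓝 G) := hG
  have hG0 : G = 0 := by
    ext1
    funext i
    refine eq_zero_of_tendsto_toL2 (ψ := fun n => (show ι →₀ FunAlg Ω from x n) i) ?_
      fun z => hpt z i
    rw [tendsto_iff_norm_sub_tendsto_zero] at hG' ⊢
    refine squeeze_zero (fun _ => norm_nonneg _) (fun n => ?_) hG'
    exact lp.norm_apply_le_norm two_ne_zero (PreFree.l2 f (x n) - G) i
  rw [hG0] at hG'
  have hcomb : Tendsto (fun n => PreFree.comb f (x n)) atTop (𝓝 (toModule f g)) := by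
    have := ((toModule f).continuous.tendsto g).comp hx
    simpa only [Function.comp_def, toModule_coe] using this
  -- Closability gives `toModule f g = 0`, so both parts of the graph norm of `x n` tend to `0`.
  rw [hf x _ hG' hcomb] at hcomb
  refine tendsto_nhds_unique hx (squeeze_zero_norm (fun n => ?_)
    (by simpa using hG'.norm.add hcomb.norm))
  rw [norm_coe]
  exact PreFree.norm_le f (x n)

/-- The completion is quasi-free relative to its generators. -/
theorem isQuasiFreeRel (hopen : IsOpen Ω) {f : ι → M} (hf : IsClosableFamily f) :
    IsQuasiFreeRel (freeCompletion f) (gen f) := by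
  have hbound : ∀ z₀ : Ω, ∃ C : ℝ, ∀ᶠ z in 𝓝 z₀, ∀ c : ι →₀ ℂ,
      √(∑ i ∈ c.support, ‖c i‖ ^ 2) ≤ C * ‖c.sum fun i a => a • loc z (gen f i)‖ := by
    intro z₀
    obtain ⟨C, hC, hev⟩ := exists_norm_apply_le_toL2 hopen z₀
    refine ⟨C, ?_⟩
    filter_upwards [hev] with z hz c
    obtain ⟨L, hL, hLC, hLφ⟩ := exists_eval f hC hz
    -- The family of constants `c`: its evaluation at any point is `c` itself.
    let y : PreFree f := c.sum fun i a => a • PreFree.gen f i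
    have hy : (c.sum fun i a => a • loc z (gen f i)) = loc z (coe f y) := by
      have : coe f y = c.sum fun i a => a • gen f i :=
        map_finsuppSum ((coeₗ f).restrictScalars ℂ) c _ |>.trans <| by
          refine Finsupp.sum_congr fun i _ => ?_
          exact ((coeₗ f).restrictScalars ℂ).map_smul _ _
      rw [this, ← locCLM_apply, map_finsuppSum]
      exact Finsupp.sum_congr fun i _ => ((locCLM _ z).map_smul _ _).symm
    rw [hy]
    refine le_trans ?_ (norm_le_mul_norm_loc L hLφ hC hLC (coe f y))
    rw [hL]
    have := sqrt_sum_le_lp_two_norm (PreFree.eval f z y) c.support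
    simpa only [y, PreFree.eval_sum_gen] using this
  refine ⟨?_, fun z => ?_, fun z => ?_, hbound, fun g => ⟨?_, ?_⟩⟩
  · rw [span_range_gen]
    exact (denseRange_coe f).closure_range
  · rw [linearIndependent_iff]
    intro c hc
    obtain ⟨C, hC⟩ := hbound z
    have h1 := hC.self_of_nhds c
    rw [Finsupp.linearCombination_apply] at hc
    rw [hc, norm_fiber_zero, mul_zero, Real.sqrt_le_left le_rfl] at h1
    ext i
    by_contra hi
    have h2 : ‖c i‖ ^ 2 ≤ ∑ i ∈ c.support, ‖c i‖ ^ 2 :=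
      Finset.single_le_sum (f := fun i => ‖c i‖ ^ 2) (fun _ _ => sq_nonneg _)
        (Finsupp.mem_support_iff.2 hi)
    have h3 : 0 < ‖c i‖ ^ 2 := by
      have : 0 < ‖c i‖ := norm_pos_iff.2 hi
      positivity
    linarith
  · set S := Submodule.span ℂ (Set.range fun i => loc z (gen f i))
    -- Localization turns the action of `φ` into the scalar `φ z`, so the `𝒜(Ω)`-span of the
    -- generators lands in the complex span of their localizations.
    have hmem : Set.range (coe f) ⊆ loc z ⁻¹' (S : Set (Fiber (freeCompletion f) z)) := by
      rw [← span_range_gen]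
      intro g hg
      refine Submodule.span_induction (p := fun g _ => loc z g ∈ S) ?_ ?_ ?_ ?_ hg
      · rintro _ ⟨i, rfl⟩
        exact Submodule.subset_span ⟨i, rfl⟩
      · rw [← locCLM_apply, map_zero]
        exact S.zero_mem
      · intro a b _ _ ha hb
        rw [← locCLM_apply, map_add]
        exact S.add_mem ha hb
      · intro φ a _ ha
        rw [loc_smul]
        exact S.smul_mem _ ha
    refine Set.eq_univ_of_forall fun y => ?_
    obtain ⟨g, rfl⟩ := loc_surjective z y
    have h1 : g ∈ closure (loc z ⁻¹' (S : Set (Fiber (freeCompletion f) z))) :=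
      closure_mono hmem (denseRange_coe f g)
    exact (locCLM _ z).continuous.closure_preimage_subset _ h1
  · exact fun hg => eq_zero_of_forall_loc_eq_zero hopen hf hg
  · rintro rfl z
    exact (locCLM _ z).map_zero

end freeCompletion

/-- A closable family defines a module map from a quasi-free module onto a dense subset of the
closed submodule that it generates. -/
theorem IsClosableFamily.exists_isQuasiFree (hopen : IsOpen Ω) {f : ι → M}
    (hf : IsClosableFamily f) :
    ∃ (R : HilbertModule.{u} Ω) (k : Cardinal.{u}) (X : R →L[FunAlg Ω] M), IsQuasiFree R k ∧
      closure (Set.range X) = closure (Submodule.span (FunAlg Ω) (Set.range f) : Set M) ∧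
      (Countable ι → k ≤ ℵ₀) := by
  rcases isEmpty_or_nonempty ι with hι | hι
  -- The rank must be at least `1`, so the empty family is replaced by a single zero vector, which
  -- generates the same submodule.
  · let f₀ : PUnit.{u + 1} → M := fun _ => 0
    have hf₀ : IsClosableFamily f₀ := by
      intro Φ h _ hlim
      have : (fun n => PreFree.comb f₀ (Φ n)) = fun _ => 0 := by
        funext n
        exact (Finsupp.linearCombination_apply _ _).trans
          (Finset.sum_eq_zero fun _ _ => smul_zero _)
      rw [this] at hlim
      exact tendsto_nhds_unique hlim tendsto_const_nhds
    refine ⟨_, 1, freeCompletion.toModule f₀, ⟨le_rfl, _, _, ?_,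
      freeCompletion.isQuasiFreeRel hopen hf₀⟩, ?_, fun _ => Cardinal.one_le_aleph0⟩
    · simp
    · rw [freeCompletion.closure_range_toModule]
      simp [f₀, Set.range_eq_empty, Set.range_const]
  · refine ⟨_, #ι, freeCompletion.toModule f, ⟨?_, _, _, rfl,
      freeCompletion.isQuasiFreeRel hopen hf⟩, freeCompletion.closure_range_toModule f,
      fun _ => Cardinal.mk_le_aleph0⟩
    exact Cardinal.one_le_iff_ne_zero.2 (Cardinal.mk_ne_zero ι)

end QuasiFreeRes

/-! ### Orthonormal families and kernels of module maps. -/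

namespace QuasiFreeRes

variable {m : ℕ} {Ω : Set (Fin m → ℂ)}

open MeasureTheory Filter

lemma countable_of_orthonormal {E ι : Type*} [NormedAddCommGroup E] [InnerProductSpace ℂ E]
    [TopologicalSpace.SeparableSpace E] {v : ι → E} (hv : Orthonormal ℂ v) : Countable ι := by
  refine Pairwise.countable_of_isOpen_disjoint (s := fun i => Metric.ball (v i) (1 / 2)) ?_
    (fun _ => Metric.isOpen_ball) fun i => ⟨v i, Metric.mem_ball_self (by norm_num)⟩
  intro i j hij
  refine Metric.ball_disjoint_ball ?_
  have h := norm_sub_sq (𝕜 := ℂ) (v i) (v j)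
  rw [hv.2 hij, hv.1, hv.1] at h
  rw [dist_eq_norm]
  norm_num at h ⊢
  nlinarith [norm_nonneg (v i - v j)]

lemma countable_of_pairwise_inner_eq_zero {E : Type*} [NormedAddCommGroup E]
    [InnerProductSpace ℂ E] [TopologicalSpace.SeparableSpace E] {T : Set E} (h0 : (0 : E) ∉ T)
    (hT : T.Pairwise fun v w => inner ℂ v w = 0) : Countable T := by
  have hne (t : T) : (t : E) ≠ 0 := fun h => h0 (h ▸ t.2)
  refine countable_of_orthonormal (v := fun t : T => ((‖(t : E)‖⁻¹ : ℝ) : ℂ) • (t : E)) ⟨?_, ?_⟩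
  · intro t
    rw [norm_smul, Complex.norm_real, norm_inv, norm_norm,
      inv_mul_cancel₀ (norm_ne_zero_iff.2 (hne t))]
  · intro s t hst
    simp [inner_smul_left, inner_smul_right,
      hT s.2 t.2 fun h => hst (Subtype.ext h)]

/-- Provides uniqueness of limits in the fibres, where closability of orthonormal families is
tested. -/
instance (M : HilbertModule.{u} Ω) (z : Ω) : T2Space (Fiber M z) :=
  haveI : IsClosed (fiberRel M z : Set (M ⊗[ℂ] ℂ)) := Submodule.isClosed_topologicalClosure _
  inferInstance

lemma IsQuasiFree.separableSpace (hbdd : Bornology.IsBounded Ω) {R : HilbertModule.{u} Ω}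
    {k : Cardinal.{u}} (hR : IsQuasiFree R k) (hk : k ≤ ℵ₀) :
    TopologicalSpace.SeparableSpace R := by
  obtain ⟨_, ι, f, rfl, hf⟩ := hR
  have := FunAlg.separableSpace hbdd
  have : Countable ι := Cardinal.mk_le_aleph0_iff.1 hk
  have h1 : TopologicalSpace.IsSeparable (Set.range f) := (Set.countable_range f).isSeparable
  have h2 := (h1.span (R := FunAlg Ω)).closure
  rw [hf.generates] at h2
  exact TopologicalSpace.isSeparable_univ_iff.1 h2

variable [IsFiniteMeasure (lebesgueOn Ω)]

/-- An orthonormal family in a module separated by its localizations is closable. -/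
lemma isClosableFamily_of_orthonormal (hopen : IsOpen Ω) {R : HilbertModule.{u} Ω}
    (hR : ∀ g : R, (∀ z, loc z g = 0) → g = 0) {ι : Type u} {f : ι → R}
    (hf : Orthonormal ℂ f) : IsClosableFamily f := by
  intro Φ h hΦ hcomb
  refine hR h fun z => ?_
  obtain ⟨C, hC, hev⟩ := exists_norm_apply_le_toL2 hopen z
  have hz := hev.self_of_nhds
  -- Replacing each coefficient by its value at `z` keeps the localization at `z`, while
  -- orthonormality turns the norm into the `ℓ²` norm of the evaluation, which the `L²` norms
  -- control.
  let y : PreFree f → R := fun Ψ => ∑ i ∈ Finsupp.support Ψ, PreFree.eval f z Ψ i • f i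
  have hloc (Ψ : PreFree f) : locCLM R z (PreFree.comb f Ψ) = locCLM R z (y Ψ) := by
    have : PreFree.comb f Ψ = ∑ i ∈ Finsupp.support Ψ, (show ι →₀ FunAlg Ω from Ψ) i • f i :=
      Finsupp.linearCombination_apply _ _
    rw [this, map_sum, map_sum]
    refine Finset.sum_congr rfl fun i _ => ?_
    rw [locCLM_apply, loc_smul, map_smul]
    rfl
  have hy (Ψ : PreFree f) : ‖y Ψ‖ ≤ C * ‖PreFree.l2 f Ψ‖ := by
    refine le_trans ?_ (PreFree.norm_eval_le f hC hz Ψ)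
    refine le_trans (le_of_eq ?_) (sqrt_sum_le_lp_two_norm (PreFree.eval f z Ψ) (Finsupp.support Ψ))
    rw [eq_comm, Real.sqrt_eq_iff_mul_self_eq (Finset.sum_nonneg fun _ _ => sq_nonneg _)
      (norm_nonneg _), ← sq, norm_sq_eq_re_inner (𝕜 := ℂ), hf.inner_sum, map_sum]
    refine Finset.sum_congr rfl fun i _ => ?_
    rw [RCLike.conj_mul]
    norm_cast
  have hy0 : Tendsto (fun n => y (Φ n)) atTop (𝓝 0) :=
    squeeze_zero_norm (fun n => hy (Φ n)) (by simpa using hΦ.norm.const_mul C)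
  have h1 := ((locCLM R z).continuous.tendsto _).comp hcomb
  have h2 := ((locCLM R z).continuous.tendsto _).comp hy0
  simp only [Function.comp_def, hloc, map_zero] at h1 h2
  exact tendsto_nhds_unique h1 h2

/-- The kernel of a module map on a module separated by its localizations is the closure of the
range of a module map from a quasi-free module. -/
theorem exists_isQuasiFree_ker (hopen : IsOpen Ω) {R N : HilbertModule.{u} Ω}
    (hR : ∀ g : R, (∀ z, loc z g = 0) → g = 0) (X : R →L[FunAlg Ω] N) :
    ∃ (R' : HilbertModule.{u} Ω) (k : Cardinal.{u}) (Y : R' →L[FunAlg Ω] R), IsQuasiFree R' k ∧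
      {x | X x = 0} = closure (Set.range Y) ∧ (TopologicalSpace.SeparableSpace R → k ≤ ℵ₀) := by
  let K : Submodule ℂ R := (LinearMap.ker X.toLinearMap).restrictScalars ℂ
  have hKmem (x : R) : x ∈ K ↔ X x = 0 := Iff.rfl
  have hK : IsClosed (K : Set R) := isClosed_eq X.continuous continuous_const
  have : CompleteSpace K := hK.completeSpace_coe
  -- A Hilbert space basis suffices: the kernel is a closed submodule, so the `𝒜(Ω)`-span of the
  -- basis stays inside it and is dense.
  obtain ⟨w, b, hb⟩ := exists_hilbertBasis ℂ K
  let f : w → R := fun i => b i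
  have hf : Orthonormal ℂ f := b.orthonormal.comp_linearIsometry K.subtypeₗᵢ
  obtain ⟨R', k, Y, hqf, hrange, hk⟩ :=
    (isClosableFamily_of_orthonormal hopen hR hf).exists_isQuasiFree hopen
  refine ⟨R', k, Y, hqf, ?_, fun _ => hk (countable_of_orthonormal hf)⟩
  rw [hrange]
  apply subset_antisymm
  · intro x hx
    have hsum := (b.hasSum_repr ⟨x, hx⟩).map K.subtypeL K.subtypeL.continuous
    refine mem_closure_of_tendsto hsum (Eventually.of_forall fun s => ?_)
    refine Submodule.sum_mem _ fun i _ => ?_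
    simp only [Function.comp_apply, map_smul]
    exact Submodule.smul_of_tower_mem _ _ (Submodule.subset_span ⟨i, rfl⟩)
  · refine closure_minimal ?_ hK
    have : Submodule.span (FunAlg Ω) (Set.range f) ≤ LinearMap.ker X.toLinearMap := by
      rw [Submodule.span_le]
      rintro _ ⟨i, rfl⟩
      exact (b i).2
    exact this

end QuasiFreeRes

/-! ### Decomposition into separable reducing submodules. -/

namespace QuasiFreeRes

variable {m : ℕ} {Ω : Set (Fin m → ℂ)}

open MeasureTheory Filter

open scoped InnerProductSpace

namespace HilbertModule

/-- The action of `φ` as a bounded operator. -/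
noncomputable def act (M : HilbertModule.{u} Ω) (φ : FunAlg Ω) : M →L[ℂ] M :=
  ⟨Algebra.lsmul ℂ ℂ (M : Type u) φ, continuous_const_smul φ⟩

@[simp] lemma act_apply (M : HilbertModule.{u} Ω) (φ : FunAlg Ω) (f : M) : M.act φ f = φ • f := rfl

/-- Every Hilbert module is the orthogonal sum of separable reducing submodules. -/
lemma exists_reducing_decomposition (hbdd : Bornology.IsBounded Ω) (M : HilbertModule.{u} Ω) :
    ∃ (T : Set M) (K : T → Submodule ℂ M), (∀ t, IsClosed (K t : Set M)) ∧
      (∀ t, TopologicalSpace.IsSeparable (K t : Set M)) ∧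
      (∀ t (φ : FunAlg Ω), ∀ x ∈ K t, φ • x ∈ K t) ∧
      (∀ t (φ : FunAlg Ω), ∀ x ∈ (K t)ᗮ, φ • x ∈ (K t)ᗮ) ∧
      (Pairwise fun s t => K s ⟂ K t) ∧ (⨆ t, K t)ᗮ = ⊥ ∧
      (TopologicalSpace.SeparableSpace M → Countable T) := by
  have := FunAlg.separableSpace hbdd
  obtain ⟨D, hDc, hD⟩ := TopologicalSpace.exists_countable_dense (FunAlg Ω)
  -- Adjoints are included so that `N`-invariant closed subspaces reduce the action; `D` is
  -- countable so that `N`-orbits are countable.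
  let G : Set (M →L[ℂ] M) := M.act '' D ∪ star '' (M.act '' D)
  let N : Submonoid (M →L[ℂ] M) := Submonoid.closure G
  have hNc : (N : Set (M →L[ℂ] M)).Countable := by
    have hG : G.Countable := (hDc.image _).union ((hDc.image _).image _)
    have : Countable G := hG.to_subtype
    have : Countable (FreeMonoid G) := inferInstanceAs (Countable (List G))
    rw [show N = MonoidHom.mrange (FreeMonoid.lift ((↑) : G → M →L[ℂ] M)) from
      Submonoid.closure_eq_mrange G]
    exact Set.countable_range _
  have hNstar (b) (hb : b ∈ N) : star b ∈ N := by
    induction hb using Submonoid.closure_induction with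
    | mem b hb =>
      refine Submonoid.subset_closure ?_
      rcases hb with hb | ⟨c, hc, rfl⟩
      · exact Or.inr ⟨b, hb, rfl⟩
      · rw [star_star]
        exact Or.inl hc
    | one => simp
    | mul b c _ _ hb hc =>
      rw [star_mul]
      exact N.mul_mem hc hb
  have hinner (b : M →L[ℂ] M) (v w : M) : ⟪b v, w⟫_ℂ = ⟪v, star b w⟫_ℂ :=
    (ContinuousLinearMap.adjoint_inner_right b v w).symm
  -- Since `N` is closed under products and adjoints, this relation is symmetric and means that the
  -- `N`-orbits of `v` and `w` are orthogonal.
  let r : M → M → Prop := fun v w => ∀ b ∈ N, ⟪v, b w⟫_ℂ = 0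
  have hrsymm : Std.Symm r := ⟨fun v w h b hb => by
    rw [← inner_conj_symm, hinner, h _ (hNstar b hb), map_zero]⟩
  let 𝒮 : Set (Set M) := {T | 0 ∉ T ∧ T.Pairwise r}
  obtain ⟨T, hT⟩ : ∃ T, Maximal (· ∈ 𝒮) T := by
    refine zorn_subset 𝒮 fun c hc hchain =>
      ⟨⋃₀ c, ⟨?_, ?_⟩, fun s hs => Set.subset_sUnion_of_mem hs⟩
    · rintro ⟨s, hs, h0⟩
      exact (hc hs).1 h0
    · exact (Set.pairwise_sUnion hchain.directedOn).2 fun s hs => (hc hs).2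
  let K₀ : T → Submodule ℂ M := fun t => Submodule.span ℂ {x | ∃ b ∈ N, x = b t}
  let K : T → Submodule ℂ M := fun t => (K₀ t).topologicalClosure
  have hclosed (t) : IsClosed (K t : Set M) := Submodule.isClosed_topologicalClosure _
  have hmemK (t : T) (b) (hb : b ∈ N) : b t ∈ K t :=
    Submodule.le_topologicalClosure _ (Submodule.subset_span ⟨b, hb, rfl⟩)
  have hinv (t : T) (b) (hb : b ∈ N) (x) (hx : x ∈ K t) : b x ∈ K t := by
    have : K t ≤ (K t).comap b.toLinearMap := by
      refine Submodule.topologicalClosure_minimal _ (Submodule.span_le.2 ?_)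
        ((hclosed t).preimage b.continuous)
      rintro _ ⟨c, hc, rfl⟩
      exact hmemK t (b * c) (N.mul_mem hb hc)
    exact this hx
  have hactN (φ) (hφ : φ ∈ D) : M.act φ ∈ N := Submonoid.subset_closure (Or.inl ⟨φ, hφ, rfl⟩)
  refine ⟨T, K, hclosed, fun t => ?_, fun t φ x hx => ?_, fun t φ x hx => ?_, fun s t hst => ?_, ?_,
    fun _ => ?_⟩
  · refine TopologicalSpace.IsSeparable.closure (TopologicalSpace.IsSeparable.span ?_)
    refine Set.Countable.isSeparable ((hNc.image fun b => b (t : M)).mono ?_)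
    rintro _ ⟨b, hb, rfl⟩
    exact ⟨b, hb, rfl⟩
  · exact closure_minimal (fun ψ hψ => hinv t _ (hactN ψ hψ) x hx)
      ((hclosed t).preimage (continuous_id.smul continuous_const)) (hD φ)
  · rw [Submodule.mem_orthogonal]
    intro y hy
    refine closure_minimal (s := D) (t := {ψ : FunAlg Ω | ⟪y, ψ • x⟫_ℂ = 0}) (fun ψ hψ => ?_)
      (isClosed_eq (continuous_const.inner (continuous_id.smul continuous_const))
        continuous_const) (hD φ)
    have h1 := hinner (star (M.act ψ)) y x
    rw [star_star, act_apply] at h1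
    rw [Set.mem_ofPred_eq, ← h1]
    exact (Submodule.mem_orthogonal _ _).1 hx _ (hinv t _ (hNstar _ (hactN ψ hψ)) y hy)
  · have h0 : K₀ s ⟂ K₀ t := by
      refine Submodule.isOrtho_span.2 ?_
      rintro _ ⟨b, hb, rfl⟩ _ ⟨c, hc, rfl⟩
      rw [hinner]
      exact hT.prop.2 s.2 t.2 (fun h => hst (Subtype.ext h)) _ (N.mul_mem (hNstar b hb) hc)
    refine Submodule.topologicalClosure_minimal _ ?_ (Submodule.isClosed_orthogonal _)
    rw [Submodule.orthogonal_closure]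
    exact h0
  · rw [Submodule.eq_bot_iff]
    intro w hw
    by_contra hw0
    -- A nonzero vector orthogonal to every `K t` could be added to `T`, against maximality.
    have hwr (t) (ht : t ∈ T) : r w t := fun b hb => by
      refine (Submodule.mem_orthogonal' _ _).1 hw _ ?_
      exact Submodule.mem_iSup_of_mem ⟨t, ht⟩ (hmemK ⟨t, ht⟩ b hb)
    have hwT : w ∉ T := fun h => hw0 (by simpa using hwr w h 1 N.one_mem)
    refine hwT (hT.le_of_ge (y := insert w T) ⟨?_, ?_⟩ (Set.subset_insert _ _) (Set.mem_insert _ _))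
    · rintro (h | h)
      · exact hw0 h.symm
      · exact hT.prop.1 h
    · exact (Set.pairwise_insert_of_symm).2 ⟨hT.prop.2, fun t ht _ => hwr t ht⟩
  · exact countable_of_pairwise_inner_eq_zero hT.prop.1
      fun s hs t ht hst => by simpa using hT.prop.2 hs ht hst 1 N.one_mem

end HilbertModule

end QuasiFreeRes

/-! ### The first map, onto a dense subspace of an almost compactly supported module. -/

namespace QuasiFreeRes

variable {m : ℕ} {Ω : Set (Fin m → ℂ)}

open MeasureTheory Filter

/-- The orthogonal projection on a reducing subspace is a module map. -/
lemma starProjection_smul {M : HilbertModule.{u} Ω} {K : Submodule ℂ M}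
    [K.HasOrthogonalProjection] (h₁ : ∀ (φ : FunAlg Ω), ∀ x ∈ K, φ • x ∈ K)
    (h₂ : ∀ (φ : FunAlg Ω), ∀ x ∈ Kᗮ, φ • x ∈ Kᗮ) (φ : FunAlg Ω) (x : M) :
    K.starProjection (φ • x) = φ • K.starProjection x := by
  refine Submodule.eq_starProjection_of_mem_of_inner_eq_zero
    (h₁ φ _ (K.starProjection_apply_mem x)) fun w hw => ?_
  rw [← smul_sub]
  exact (Submodule.mem_orthogonal' _ _).1 (h₂ φ _ (K.sub_starProjection_mem_orthogonal x)) w hw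

variable [IsFiniteMeasure (lebesgueOn Ω)]

/-- The orbit map `φ ↦ φ f` is bounded for the `L²` norm. -/
def IsL2Bounded {M : HilbertModule.{u} Ω} (f : M) : Prop :=
  ∃ C : ℝ, 0 ≤ C ∧ ∀ φ : FunAlg Ω, ‖φ • f‖ ≤ C * ‖toL2 Ω φ‖

/-- The only use of compact support: the supremum over a compact subset of `Ω` is dominated by the
`L²` norm. -/
lemma CompactlySupportedOn.isL2Bounded (hopen : IsOpen Ω) {M : HilbertModule.{u} Ω} {f : M}
    (hf : CompactlySupportedOn M f) : IsL2Bounded f := by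
  obtain ⟨X, β, hX, h⟩ := hf
  obtain ⟨C, hC, hXC⟩ := exists_supNormOn_le_toL2 hopen hX
  refine ⟨|β| * C * ‖f‖, by positivity, fun φ => (h φ).trans ?_⟩
  have h0 : 0 ≤ supNormOn X φ := Real.iSup_nonneg fun _ => norm_nonneg _
  calc β * supNormOn X φ * ‖f‖ ≤ |β| * supNormOn X φ * ‖f‖ := by gcongr; exact le_abs_self β
    _ ≤ |β| * (C * ‖toL2 Ω φ‖) * ‖f‖ := by gcongr; exact hXC φ
    _ = |β| * C * ‖f‖ * ‖toL2 Ω φ‖ := by ring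

/-- A separable reducing subspace of a module in which the `L²`-bounded vectors are total has a
sequence whose orbit maps have geometrically decreasing bounds and whose span is dense. -/
lemma exists_seq_of_isSeparable {M : HilbertModule.{u} Ω} {K : Submodule ℂ M}
    [K.HasOrthogonalProjection] (hK : TopologicalSpace.IsSeparable (K : Set M))
    (h₁ : ∀ (φ : FunAlg Ω), ∀ x ∈ K, φ • x ∈ K) (h₂ : ∀ (φ : FunAlg Ω), ∀ x ∈ Kᗮ, φ • x ∈ Kᗮ)
    (hM : closure (Submodule.span ℂ {f : M | IsL2Bounded f} : Set M) = Set.univ) :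
    ∃ q : ℕ → M, (∀ k, q k ∈ K) ∧
      (∀ k (φ : FunAlg Ω), ‖φ • q k‖ ≤ (1 / 2) ^ k * ‖toL2 Ω φ‖) ∧
      K ≤ (Submodule.span ℂ (Set.range q)).topologicalClosure := by
  set P := K.starProjection with hP
  have hsub : P '' {f : M | IsL2Bounded f} ⊆ K := by
    rintro _ ⟨f, _, rfl⟩
    exact K.starProjection_apply_mem f
  obtain ⟨s, hs, hsc, hdense⟩ := (hK.mono hsub).exists_countable_dense_subset
  have hne : s.Nonempty := by
    have h0 : (0 : M) ∈ P '' {f : M | IsL2Bounded f} := ⟨0, ⟨0, le_rfl, by simp⟩, map_zero _⟩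
    exact closure_nonempty_iff.1 ⟨0, hdense h0⟩
  obtain ⟨p, rfl⟩ := hsc.exists_eq_range hne
  -- The projection is a contraction and a module map, so it preserves orbit bounds.
  have hp (k) : ∃ C : ℝ, 0 ≤ C ∧ ∀ φ : FunAlg Ω, ‖φ • p k‖ ≤ C * ‖toL2 Ω φ‖ := by
    obtain ⟨f, ⟨C, hC, hf⟩, hfp⟩ := hs ⟨k, rfl⟩
    refine ⟨C, hC, fun φ => ?_⟩
    rw [← hfp, hP, ← starProjection_smul h₁ h₂]
    exact (K.norm_starProjection_apply_le _).trans (hf φ)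
  choose C hC hpC using hp
  -- Scaling leaves the span unchanged; the `+ 1` keeps the denominator positive.
  let c : ℕ → ℝ := fun k => (1 / 2) ^ k / (C k + 1)
  have hc (k) : 0 < c k := by have := hC k; positivity
  refine ⟨fun k => (c k : ℂ) • p k, fun k => K.smul_mem _ (hsub (hs ⟨k, rfl⟩)), fun k φ => ?_, ?_⟩
  · rw [smul_comm, norm_smul, Complex.norm_real, Real.norm_of_nonneg (hc k).le]
    have hCk := hC k
    calc c k * ‖φ • p k‖ ≤ c k * ((C k + 1) * ‖toL2 Ω φ‖) := by
          have := hpC k φ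
          have := hc k
          gcongr
          nlinarith [norm_nonneg (toL2 Ω φ)]
      _ = (1 / 2) ^ k * ‖toL2 Ω φ‖ := by
          simp only [c]
          field_simp
  · set S := (Submodule.span ℂ (Set.range fun k => (c k : ℂ) • p k)).topologicalClosure
    have hSc : IsClosed (S : Set M) := Submodule.isClosed_topologicalClosure _
    have hpS : Set.range p ⊆ S := by
      rintro _ ⟨k, rfl⟩
      have h1 : (c k : ℂ) • p k ∈ S :=
        Submodule.le_topologicalClosure _ (Submodule.subset_span ⟨k, rfl⟩)
      have h2 := S.smul_mem ((c k : ℂ)⁻¹) h1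
      rwa [inv_smul_smul₀ (by exact_mod_cast (hc k).ne')] at h2
    have hall (x : M) : P x ∈ S := by
      have hle : Submodule.span ℂ {f : M | IsL2Bounded f} ≤ S.comap P.toLinearMap := by
        refine Submodule.span_le.2 fun f hf => ?_
        exact closure_minimal hpS hSc (hdense ⟨f, hf, rfl⟩)
      exact closure_minimal hle (hSc.preimage P.continuous) (hM ▸ Set.mem_univ x)
    intro x hx
    have := hall x
    rwa [hP, Submodule.starProjection_eq_self_iff.2 hx] at this

/-- Families in mutually orthogonal reducing subspaces with geometrically decreasing orbit bounds
are closable. -/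
lemma isClosableFamily_of_orthogonal {M : HilbertModule.{u} Ω} {T : Type u} {K : T → Submodule ℂ M}
    [∀ t, (K t).HasOrthogonalProjection]
    (h₁ : ∀ t (φ : FunAlg Ω), ∀ x ∈ K t, φ • x ∈ K t)
    (h₂ : ∀ t (φ : FunAlg Ω), ∀ x ∈ (K t)ᗮ, φ • x ∈ (K t)ᗮ)
    (horth : Pairwise fun s t => K s ⟂ K t) (htot : (⨆ t, K t)ᗮ = ⊥) {q : T → ℕ → M}
    (hq : ∀ t k, q t k ∈ K t)
    (hbound : ∀ t k (φ : FunAlg Ω), ‖φ • q t k‖ ≤ (1 / 2) ^ k * ‖toL2 Ω φ‖) :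
    IsClosableFamily fun p : T × ℕ => q p.1 p.2 := by
  classical
  set f : T × ℕ → M := fun p => q p.1 p.2
  intro Φ h hΦ hcomb
  -- The projection on `K t` retains only the terms with first index `t`; their bounds sum to at
  -- most `∑ (1 / 2) ^ k = 2`. No uniformity of the whole sum over `T` is required.
  have key (t : T) (Ψ : PreFree f) :
      ‖(K t).starProjection (PreFree.comb f Ψ)‖ ≤ 2 * ‖PreFree.l2 f Ψ‖ := by
    let ψ : T × ℕ →₀ FunAlg Ω := Ψ
    have hsum : PreFree.comb f Ψ = ∑ p ∈ ψ.support, ψ p • f p :=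
      Finsupp.linearCombination_apply _ _
    have hterm (p : T × ℕ) : (K t).starProjection (ψ p • f p) =
        if p.1 = t then ψ p • f p else 0 := by
      split_ifs with hpt
      · exact Submodule.starProjection_eq_self_iff.2 (h₁ t _ _ (hpt ▸ hq p.1 p.2))
      · refine (Submodule.starProjection_apply_eq_zero_iff _).2 ?_
        exact h₂ t _ _ (horth hpt (hq p.1 p.2))
    rw [hsum, map_sum, Finset.sum_congr rfl fun p _ => hterm p, ← Finset.sum_filter]
    have hinj : Set.InjOn Prod.snd
        ((ψ.support.filter fun p => p.1 = t : Finset (T × ℕ)) : Set (T × ℕ)) := by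
      intro a ha b hb hab
      rw [Finset.mem_coe, Finset.mem_filter] at ha hb
      exact Prod.ext (ha.2.trans hb.2.symm) hab
    calc ‖∑ p ∈ ψ.support with p.1 = t, ψ p • f p‖
        ≤ ∑ p ∈ ψ.support with p.1 = t, (1 / 2) ^ p.2 * ‖PreFree.l2 f Ψ‖ := by
          refine norm_sum_le_of_le _ fun p _ => (hbound p.1 p.2 (ψ p)).trans ?_
          gcongr
          exact lp.norm_apply_le_norm two_ne_zero (PreFree.l2 f Ψ) p
      _ = (∑ k ∈ (ψ.support.filter fun p => p.1 = t).image Prod.snd, (1 / 2 : ℝ) ^ k) *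
            ‖PreFree.l2 f Ψ‖ := by
          rw [Finset.sum_image hinj, Finset.sum_mul]
      _ ≤ 2 * ‖PreFree.l2 f Ψ‖ := by
          gcongr
          exact (summable_geometric_two.sum_le_tsum _ fun _ _ => by positivity).trans_eq
            tsum_geometric_two
  have hzero (t : T) : (K t).starProjection h = 0 := by
    refine tendsto_nhds_unique (((K t).starProjection.continuous.tendsto h).comp hcomb) ?_
    exact squeeze_zero_norm (fun n => key t (Φ n)) (by simpa using hΦ.norm.const_mul 2)
  have hmem : h ∈ (⨆ t, K t)ᗮ := by
    rw [← Submodule.iInf_orthogonal, Submodule.mem_iInf]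
    exact fun t => (Submodule.starProjection_apply_eq_zero_iff _).1 (hzero t)
  rwa [htot, Submodule.mem_bot] at hmem

/-- An almost compactly supported module receives a module map with dense range from a quasi-free
module. -/
theorem IsAlmostCompactlySupported.exists_isQuasiFree (hopen : IsOpen Ω)
    (hbdd : Bornology.IsBounded Ω) {M : HilbertModule.{u} Ω} (hM : IsAlmostCompactlySupported M) :
    ∃ (R : HilbertModule.{u} Ω) (k : Cardinal.{u}) (X : R →L[FunAlg Ω] M), IsQuasiFree R k ∧
      DenseRange X ∧ (TopologicalSpace.SeparableSpace M → k ≤ ℵ₀) := by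
  have hM' : closure (Submodule.span ℂ {f : M | IsL2Bounded f} : Set M) = Set.univ := by
    refine Set.eq_univ_of_univ_subset (hM.symm.subset.trans (closure_mono ?_))
    exact Submodule.span_mono fun f hf => CompactlySupportedOn.isL2Bounded hopen hf
  obtain ⟨T, K, hclosed, hsep, h₁, h₂, horth, htot, hT⟩ := M.exists_reducing_decomposition hbdd
  have hcomplete (t : T) : CompleteSpace (K t) := (hclosed t).completeSpace_coe
  have hseq (t : T) := exists_seq_of_isSeparable (hsep t) (h₁ t) (h₂ t) hM'
  choose q hq hbound hdense using hseq
  obtain ⟨R, k, X, hR, hX, hk⟩ :=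
    (isClosableFamily_of_orthogonal h₁ h₂ horth htot hq hbound).exists_isQuasiFree hopen
  refine ⟨R, k, X, hR, ?_, fun hs => hk (have := hT hs; inferInstance)⟩
  rw [DenseRange, dense_iff_closure_eq, hX]
  set f : T × ℕ → M := fun p => q p.1 p.2
  let S : Submodule ℂ M :=
    ((Submodule.span (FunAlg Ω) (Set.range f)).restrictScalars ℂ).topologicalClosure
  have hS : S = ⊤ := by
    rw [← (Submodule.isClosed_topologicalClosure _).submodule_topologicalClosure_eq (s := S),
      Submodule.topologicalClosure_eq_top_iff, eq_bot_iff, ← htot]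
    refine Submodule.orthogonal_le (iSup_le fun t => (hdense t).trans ?_)
    refine Submodule.topologicalClosure_mono (Submodule.span_le.2 ?_)
    rintro _ ⟨k, rfl⟩
    exact Submodule.subset_span (s := Set.range f) ⟨(t, k), rfl⟩
  exact congrArg (fun S : Submodule ℂ M => (S : Set M)) hS

end QuasiFreeRes

/-! ### Iteration to a weak resolution. -/

namespace QuasiFreeRes

variable {m : ℕ} {Ω : Set (Fin m → ℂ)}

section Resolution

variable [MeasureTheory.IsFiniteMeasure (lebesgueOn Ω)]

/-- A module map from a quasi-free module, of countable rank under the hypothesis `s`. -/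
structure QuasiFreeMap (Ω : Set (Fin m → ℂ)) (s : Prop) where
  source : HilbertModule.{u} Ω
  target : HilbertModule.{u} Ω
  rank : Cardinal.{u}
  map : source →L[FunAlg Ω] target
  quasiFree : IsQuasiFree source rank
  rank_le : s → rank ≤ ℵ₀

/-- Quasi-freeness of the source supplies the separation that the kernel construction needs.
Countable rank makes the source separable, so the next rank is again countable. -/
lemma QuasiFreeMap.exists_next (hopen : IsOpen Ω) (hbdd : Bornology.IsBounded Ω) {s : Prop}
    (a : QuasiFreeMap.{u} Ω s) :
    ∃ (R : HilbertModule.{u} Ω) (k : Cardinal.{u}) (Y : R →L[FunAlg Ω] a.source),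
      IsQuasiFree R k ∧ {x | a.map x = 0} = closure (Set.range Y) ∧ (s → k ≤ ℵ₀) := by
  obtain ⟨_, ι, f, _, hf⟩ := id a.quasiFree
  obtain ⟨R, k, Y, hR, hY, hk⟩ :=
    exists_isQuasiFree_ker hopen (fun g => (hf.separates g).1) a.map
  exact ⟨R, k, Y, hR, hY, fun hs => hk (a.quasiFree.separableSpace hbdd (a.rank_le hs))⟩

/-- The next map of a weak resolution. -/
noncomputable def QuasiFreeMap.next (hopen : IsOpen Ω) (hbdd : Bornology.IsBounded Ω) {s : Prop}
    (a : QuasiFreeMap.{u} Ω s) : QuasiFreeMap.{u} Ω s where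
  source := (a.exists_next hopen hbdd).choose
  target := a.source
  rank := (a.exists_next hopen hbdd).choose_spec.choose
  map := (a.exists_next hopen hbdd).choose_spec.choose_spec.choose
  quasiFree := (a.exists_next hopen hbdd).choose_spec.choose_spec.choose_spec.1
  rank_le := (a.exists_next hopen hbdd).choose_spec.choose_spec.choose_spec.2.2

lemma QuasiFreeMap.ker_eq (hopen : IsOpen Ω) (hbdd : Bornology.IsBounded Ω) {s : Prop}
    (a : QuasiFreeMap.{u} Ω s) :
    {x | a.map x = 0} = closure (Set.range (a.next hopen hbdd).map) :=
  (a.exists_next hopen hbdd).choose_spec.choose_spec.choose_spec.2.1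

/-- The sequence of maps of the weak resolution that starts with `a`. -/
noncomputable def QuasiFreeMap.iter (hopen : IsOpen Ω) (hbdd : Bornology.IsBounded Ω) {s : Prop}
    (a : QuasiFreeMap.{u} Ω s) : ℕ → QuasiFreeMap.{u} Ω s
  | 0 => a
  | n + 1 => (a.iter hopen hbdd n).next hopen hbdd

/-- The weak resolution that starts with a given map of dense range. -/
noncomputable def QuasiFreeMap.weakResolution (hopen : IsOpen Ω) (hbdd : Bornology.IsBounded Ω)
    {s : Prop} (a : QuasiFreeMap.{u} Ω s) (ha : DenseRange a.map) : WeakResolution a.target where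
  -- The sequence never stops: even a zero kernel is covered by a quasi-free module of rank `1`.
  length := ⊤
  term n := (a.iter hopen hbdd n).source
  rank n := (a.iter hopen hbdd n).rank
  quasiFree n _ := (a.iter hopen hbdd n).quasiFree
  eq_zero n hn := absurd hn (by simp)
  aug := a.map
  map n := (a.iter hopen hbdd (n + 1)).map
  denseRange_aug := ha
  ker_aug := a.ker_eq hopen hbdd
  ker_map n := (a.iter hopen hbdd (n + 1)).ker_eq hopen hbdd

end Resolution

/-- Positive length guarantees that term `0` is quasi-free, so the augmentation witnesses weak
regularity. -/
lemma IsAlmostCompactlySupported.exists_weakResolution (hopen : IsOpen Ω)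
    (hbdd : Bornology.IsBounded Ω) {M : HilbertModule.{u} Ω} (hM : IsAlmostCompactlySupported M) :
    ∃ P : WeakResolution M, 0 < P.length ∧ (TopologicalSpace.SeparableSpace M →
      ∀ n : ℕ, (n : ℕ∞) < P.length → P.rank n ≤ ℵ₀) := by
  have := isFiniteMeasure_lebesgueOn hopen hbdd
  obtain ⟨R, k, X, hR, hX, hk⟩ := hM.exists_isQuasiFree hopen hbdd
  let a : QuasiFreeMap.{u} Ω (TopologicalSpace.SeparableSpace M) := ⟨R, M, k, X, hR, hk⟩
  exact ⟨a.weakResolution hopen hbdd hX, ENat.top_pos,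
    fun hs n _ => (a.iter hopen hbdd n).rank_le hs⟩

lemma IsCompactlySupported.isAlmostCompactlySupported {M : HilbertModule.{u} Ω}
    (hM : IsCompactlySupported M) : IsAlmostCompactlySupported M := by
  obtain ⟨X, β, hX, h⟩ := hM
  have : {f : M | CompactlySupportedOn M f} = Set.univ :=
    Set.eq_univ_of_forall fun f => ⟨X, β, hX, h f⟩
  rw [IsAlmostCompactlySupported, this, Submodule.span_univ]
  simp

end QuasiFreeRes

theorem theorem3 {m : ℕ} (Ω : Set (Fin m → ℂ)) (hopen : IsOpen Ω) (hconn : IsConnected Ω)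
    (hbdd : Bornology.IsBounded Ω) (M : QuasiFreeRes.HilbertModule.{u} Ω) :
    (QuasiFreeRes.IsAlmostCompactlySupported M →
      ∃ P : QuasiFreeRes.WeakResolution M, TopologicalSpace.SeparableSpace M →
        ∀ n : ℕ, (n : ℕ∞) < P.length → P.rank n ≤ ℵ₀) ∧
    (QuasiFreeRes.IsCompactlySupported M → QuasiFreeRes.IsWeaklyRegular M) := by
  have key := fun hM : QuasiFreeRes.IsAlmostCompactlySupported M =>
    hM.exists_weakResolution hopen hbdd
  refine ⟨fun hM => ?_, fun hM => ?_⟩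
  · obtain ⟨P, -, hP⟩ := key hM
    exact ⟨P, hP⟩
  · obtain ⟨P, hpos, -⟩ := key hM.isAlmostCompactlySupported
    exact ⟨P.term 0, P.rank 0, P.aug, P.quasiFree 0 hpos, P.denseRange_aug⟩
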